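/- Two agents $1,2$ with budgets $B_1,B_2\ge 0$ compete for $k\ge 1$ identical items, sold one after the other in $k$ first-price sealed-bid auctions; agent $i$ values each item at $v_i$. Write $-i$ for the opponent of $i$. Besides each bid $b$ there is the bid $b+$, which beats $b$, loses to every $c>b$, and pays $b$ when it wins; equal bids are resolved by a fair coin, independently in each round. The utility of an agent is the value of the items she wins plus her leftover budget. The canonical outcome is defined recursively, and $U^{(k)}_i(B_i,B_{-i})$ denotes the expected utility of agent $i$ in the canonical outcome with $k$ items. For $k=1$: if $B_i>B_{-i}$, agent $i$ bids $B_{-i}+$ and agent $-i$ bids $B_{-i}$; if $B_1=B_2$, both bid this common value. For $k\ge 2$, let, for $0\le p\le B_i$, $$W^{(k)}_i(p)=v_i+U^{(k-1)}_i(B_i-p,\,B_{-i}),\qquad L^{(k)}_i(p)=U^{(k-1)}_i\bigl(B_i,\,\max(B_{-i}-p,0)\bigr),$$ and let the critical price of agent $i$ be the price $p_i\in[0,B_i]$ such that $W^{(k)}_i(p)<L^{(k)}_i(p)$ for all $p\in[0,B_i]$ with $p>p_i$, and $W^{(k)}_i(p)>L^{(k)}_i(p)$ for all $p\in[0,B_i]$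 with $p<p_i$. If $p_i>p_{-i}$, then in the first round agent $i$ bids $p_{-i}+$ and agent $-i$ bids $p_{-i}$; if $p_1=p_2$, both bid this common price. Afterwards both follow the canonical outcome of the auction with $k-1$ items and the remaining budgets. **Proposition.** Consider only budgets with $2^kB_1<v_1,v_2$ and $2^kB_2<v_1,v_2$. For all such budgets the construction is well defined: if $k\ge 2$, each agent has exactly one critical price. Moreover, for $i=1,2$, among such budgets $U^{(k)}_i(B_i,B_{-i})$ is strictly increasing in $B_i$ and non-increasing in $B_{-i}$. -/

import Mathlib

open scoped BigOperators

/-- The two agents. -/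
abbrev Agent := Fin 2

/-- The other agent, written `-i` in the mathematics. -/
def opponent (i : Agent) : Agent := 1 - i

/-- A bid `b` is `(b, false)` and the infinitesimally larger bid `b+` is `(b, true)`.
The order is lexicographic, so `b < b+`, and `b+ < c` for all real `c > b`. -/
abbrev Bid := ℝ ×ₗ Bool

/-- The bid `b`. -/
def plainBid (b : ℝ) : Bid := toLex (b, false)

/-- The bid `b+`. -/
def plusBid (b : ℝ) : Bid := toLex (b, true)

/-- The amount charged if the bid wins: `b` for the bid `b` and `b` for the bid `b+`. -/
def Bid.price (b : Bid) : ℝ := (ofLex b).1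

/-- Winner of a round of the sealed-bid auction: the higher bidder; if both bids are the same,
the agent drawn by the tie-breaking coin. -/
noncomputable def roundWinner (bids : Agent → Bid) (coin : Agent) : Agent :=
  if bids 1 < bids 0 then 0 else if bids 0 < bids 1 then 1 else coin

/-- The budgets after agent `w` has paid `p`. -/
noncomputable def charge (B : Agent → ℝ) (w : Agent) (p : ℝ) : Agent → ℝ :=
  Function.update B w (B w - p)

/-- Result of a whole auction: the number of items won by each agent, and the leftover budgets. -/
structure AuctionResult where
  /-- Number of items won by each agent. -/
  items : Agent → ℕ
  /-- Budget of each agent at the end of the auction. -/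
  leftover : Agent → ℝ

/-- Utility of an agent: value of the items won plus leftover budget. -/
def AuctionResult.utility (r : AuctionResult) (v : Agent → ℝ) (i : Agent) : ℝ :=
  v i * (r.items i : ℝ) + r.leftover i

/-- Winning utility `W_i(B_i, B_{-i}, p)`, where `U B i` is the utility of agent `i` in the
remaining auction with budgets `B`. -/
noncomputable def winningUtility (v : Agent → ℝ) (U : (Agent → ℝ) → Agent → ℝ)
    (i : Agent) (B : Agent → ℝ) (p : ℝ) : ℝ :=
  v i + U (charge B i p) i

/-- Losing utility `L_i(B_i, B_{-i}, p)`: the opponent wins at price `p`. At a price that the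
opponent cannot afford (where the opponent never wins), it is continued by the value for
an opponent who has no money left. -/
noncomputable def losingUtility (U : (Agent → ℝ) → Agent → ℝ)
    (i : Agent) (B : Agent → ℝ) (p : ℝ) : ℝ :=
  U (charge B (opponent i) (min p (B (opponent i)))) i

/-- `p` is the critical price of agent `i`: among the prices in `[0, B_i]` that she can pay, she
strictly prefers winning at all lower ones and losing at all higher ones. If she prefers winning
at all prices below `B_i`, this is the price `B_i`. -/
def IsCriticalPrice (v : Agent → ℝ) (U : (Agent → ℝ) → Agent → ℝ)
    (i : Agent) (B : Agent → ℝ) (p : ℝ) : Prop :=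
  p ∈ Set.Icc 0 (B i) ∧
  (∀ q ∈ Set.Icc 0 (B i), p < q → winningUtility v U i B q < losingUtility U i B q) ∧
  (∀ q ∈ Set.Icc 0 (B i), q < p → losingUtility U i B q < winningUtility v U i B q)

/-- A critical price is unique. -/
theorem IsCriticalPrice.unique {v : Agent → ℝ} {U : (Agent → ℝ) → Agent → ℝ}
    {i : Agent} {B : Agent → ℝ} {p p' : ℝ}
    (h : IsCriticalPrice v U i B p) (h' : IsCriticalPrice v U i B p') : p = p' := by
  have key : ∀ {a b : ℝ}, IsCriticalPrice v U i B a → IsCriticalPrice v U i B b → ¬ a < b := by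
    intro a b ha hb hab
    have hm : (a + b) / 2 ∈ Set.Icc 0 (B i) :=
      ⟨by linarith [ha.1.1, hb.1.1], by linarith [ha.1.2, hb.1.2]⟩
    exact lt_asymm (ha.2.1 _ hm (by linarith)) (hb.2.2 _ hm (by linarith))
  exact le_antisymm (not_lt.1 (key h' h)) (not_lt.1 (key h h'))

open Classical in
/-- The critical price of agent `i` (the value `B i` in the second branch is a default, for the
case that no critical price exists). -/
noncomputable def criticalPrice (v : Agent → ℝ) (U : (Agent → ℝ) → Agent → ℝ)
    (i : Agent) (B : Agent → ℝ) : ℝ :=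
  if h : ∃ p, IsCriticalPrice v U i B p then h.choose else B i

/-- The price up to which agent `i` competes for the first item when `k` further items follow:
her budget if it is the only item, and her critical price otherwise. -/
noncomputable def reservePrice (v : Agent → ℝ) (k : ℕ) (U : (Agent → ℝ) → Agent → ℝ)
    (B : Agent → ℝ) (i : Agent) : ℝ :=
  if k = 0 then B i else criticalPrice v U i B

/-- First-round bids: the agent `i` with the larger price bids `p_{-i}+` and the other one bids
`p_{-i}`; if the prices are the same, both agents bid this price. -/
noncomputable def canonicalBids (p : Agent → ℝ) (i : Agent) : Bid :=
  if p (opponent i) < p i then plusBid (p (opponent i)) else plainBid (p i)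

/-- The canonical outcome of the sequential auction with `k` items and budgets `B`, as a function
of the tie-breaking coins `ω` of the `k` rounds. Its recursive step uses the (expected) canonical
utilities `U` of the auction with one item less. -/
noncomputable def canonicalOutcome (v : Agent → ℝ) :
    (k : ℕ) → (Agent → ℝ) → (Fin k → Agent) → AuctionResult
  | 0, B, _ => ⟨fun _ => 0, B⟩
  | k + 1, B, ω =>
    let U : (Agent → ℝ) → Agent → ℝ := fun B' i =>
      Finset.univ.expect fun ω' : Fin k → Agent => (canonicalOutcome v k B' ω').utility v i
    let bids := canonicalBids (reservePrice v k U B)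
    let w := roundWinner bids (ω 0)
    let rest := canonicalOutcome v k (charge B w (bids w).price) (Fin.tail ω)
    ⟨fun i => (if i = w then 1 else 0) + rest.items i, rest.leftover⟩

/-- Expected utility of agent `i` in the canonical outcome with `k` items and budgets `B`, over
independent fair tie-breaking coins. -/
noncomputable def canonicalUtility (v : Agent → ℝ) (k : ℕ) (B : Agent → ℝ) (i : Agent) : ℝ :=
  Finset.univ.expect fun ω : Fin k → Agent => (canonicalOutcome v k B ω).utility v i

/-- The budget profile in which agent `i` has budget `x` and her opponent has budget `y`. -/
def budgets (i : Agent) (x y : ℝ) : Agent → ℝ := fun j => if j = i then x else y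

/-- Standing assumption: budgets are nonnegative, and the values dominate them:
`v_1, v_2 > 2^k B_1, 2^k B_2`. -/
def ValuesDominate (k : ℕ) (v B : Agent → ℝ) : Prop :=
  (∀ i, 0 ≤ B i) ∧ ∀ i j, 2 ^ k * B j < v i

theorem reservePrice_mem (v : Agent → ℝ) (k : ℕ) (U : (Agent → ℝ) → Agent → ℝ)
    (B : Agent → ℝ) (hB : ∀ i, 0 ≤ B i) (i : Agent) :
    reservePrice v k U B i ∈ Set.Icc 0 (B i) := by
  unfold reservePrice criticalPrice
  split_ifs with h0 h
  · exact ⟨hB i, le_rfl⟩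
  · exact h.choose_spec.1
  · exact ⟨hB i, le_rfl⟩

/-- The winner of a round never pays more than her own price. -/
theorem canonical_price_le (p : Agent → ℝ) (c : Agent) :
    (canonicalBids p (roundWinner (canonicalBids p) c)).price ≤
      p (roundWinner (canonicalBids p) c) := by
  generalize roundWinner (canonicalBids p) c = w
  unfold canonicalBids
  split_ifs with h
  · exact h.le
  · exact le_rfl

/-- No agent ever exceeds her budget in the canonical outcome, so that the convention that such an
agent has utility `-∞` is never used. -/
theorem canonicalOutcome_leftover_nonneg (v : Agent → ℝ) (k : ℕ) (B : Agent → ℝ)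
    (hB : ∀ i, 0 ≤ B i) (ω : Fin k → Agent) (i : Agent) :
    0 ≤ (canonicalOutcome v k B ω).leftover i := by
  induction k generalizing B with
  | zero => exact hB i
  | succ k ih =>
    simp only [canonicalOutcome]
    apply ih
    intro j
    unfold charge
    by_cases hj : j = roundWinner (canonicalBids (reservePrice v k (fun B' i =>
        Finset.univ.expect fun ω' : Fin k → Agent =>
          (canonicalOutcome v k B' ω').utility v i) B)) (ω 0)
    · subst hj
      rw [Function.update_self]
      exact sub_nonneg.2 ((canonical_price_le _ _).trans (reservePrice_mem v k _ B hB _).2)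
    · rw [Function.update_of_ne hj]
      exact hB j

/-! Because values dwarf budgets, the number of items an agent gets counts first and leftover money
second. With `n + c = k` and positive budgets, an agent with budget `x` facing `y` gets `n` items
when `n * y < (c + 1) * x` and `c * x < (n + 1) * y`. On the boundary `c * x = (n + 1) * y`, `c ≠
0`, the coins decide, and her utility lies between `n * v + v / 2 ^ k` and `(n + 1) * v`.

Suppose `x / (n + 1) ≤ y / (c + 1)`. In effect the first agent buys her `n` items first, and her
final leftover `ℓ` is then the price of each of the opponent's `c` items. The utilities are
therefore `n * v + ℓ` and `c * v' + (y - c * ℓ)`, with `ℓ = leftoverFun n c x y`. The price of the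
first item is the opponent's critical price. It is her point of indifference (the zero of
`winLoss`), unless that lies below `y - (c + 1) * x / (n + 1)`. Below this floor, winning leaves her
rich enough to gain one item more, so she certainly competes; hence the maximum in `stopPrice`. The
minimum in `leftoverFun` extends the true value `x - (n + 1) * y` beyond its region in such a way
that monotonicity and the bound `x / (n + 1)` hold for all nonnegative `x`.

Two facts carry the proof. The functions `leftoverFun` are strictly increasing in the own budget and
non-increasing in the other (`IsMonoAnti.step`). The canonical utilities have the form just
described (`UtilityForm`), by induction on `k`: the form yields monotonicity (`UtilityForm.mono`),
since changing the number of items outweighs any change in money; monotonicity yields critical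
prices (`UtilityMono.exists_isCrit`); and these determine the first round with `k + 1` items
(`UtilityForm.succ`). -/

/-! ### Leftover functions and first prices -/

/-- A zero of a real function (junk if there is none). -/
noncomputable def zeroOf (h : ℝ → ℝ) : ℝ := Classical.epsilon fun q => h q = 0

theorem zeroOf_spec {h : ℝ → ℝ} (hh : ∃ q, h q = 0) : h (zeroOf h) = 0 :=
  Classical.epsilon_spec hh

/-- With `A` and `B` the leftover functions after the first and the second agent have won, this is
the second agent's loss, in leftover money, from winning rather than losing at price `q`. -/
noncomputable def winLoss (A B : ℝ → ℝ → ℝ) (c : ℕ) (x y q : ℝ) : ℝ :=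
  q + c * B x (y - q) - (c + 1) * A (x - q) y

/-- The price at which the second agent stops competing. -/
noncomputable def stopPrice (A B : ℝ → ℝ → ℝ) (n c : ℕ) (x y : ℝ) : ℝ :=
  max (zeroOf (winLoss A B c x y)) (y - (c + 1) * x / (n + 1))

/-- Leftover budget of an agent with budget `x` who wins `n` items against an opponent with budget
`y` who wins `c` items, when `(c + 1) * x ≤ (n + 1) * y`. -/
noncomputable def leftoverFun : ℕ → ℕ → ℝ → ℝ → ℝ
  | 0, _ => fun x _ => x
  | n + 1, 0 => fun x y => min (x / (n + 2)) (x - (n + 1) * y)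
  | n + 1, c + 1 => fun x y =>
    leftoverFun n (c + 1)
      (x - stopPrice (leftoverFun n (c + 1)) (leftoverFun (n + 1) c) n c x y) y

/-- The price of the first item when the two agents are to win `n + 1` and `c + 1` items. -/
noncomputable def firstPrice (n c : ℕ) (x y : ℝ) : ℝ :=
  stopPrice (leftoverFun n (c + 1)) (leftoverFun (n + 1) c) n c x y

theorem leftoverFun_zero (c : ℕ) (x y : ℝ) : leftoverFun 0 c x y = x := by
  simp [leftoverFun]

theorem leftoverFun_succ_zero (n : ℕ) (x y : ℝ) :
    leftoverFun (n + 1) 0 x y = min (x / (n + 2)) (x - (n + 1) * y) := by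
  simp [leftoverFun]

theorem leftoverFun_succ_succ (n c : ℕ) (x y : ℝ) :
    leftoverFun (n + 1) (c + 1) x y = leftoverFun n (c + 1) (x - firstPrice n c x y) y := by
  rw [firstPrice, leftoverFun]

/-! ### Continuity and monotonicity of the leftover functions -/

/-- Continuous, strictly increasing in the first and non-increasing in the second argument. -/
structure IsMonoAnti (A : ℝ → ℝ → ℝ) : Prop where
  cont : Continuous fun z : ℝ × ℝ => A z.1 z.2
  mono : ∀ y, StrictMono fun x => A x y
  anti : ∀ x, Antitone fun y => A x y

section
variable {A B : ℝ → ℝ → ℝ} (hA : IsMonoAnti A) (hB : IsMonoAnti B) (c : ℕ)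
include hA hB

/-- A higher price lowers `A (x - q) y` and does not lower `B x (y - q)`, so the loss has slope at
least one in `q`. This gives existence and uniqueness of its zero. -/
theorem winLoss_add_le {x y q q' : ℝ} (h : q ≤ q') :
    winLoss A B c x y q + (q' - q) ≤ winLoss A B c x y q' := by
  unfold winLoss
  have h1 : A (x - q') y ≤ A (x - q) y := (hA.mono y).monotone (by linarith)
  have h2 : B x (y - q) ≤ B x (y - q') := hB.anti x (by linarith)
  have h3 := mul_le_mul_of_nonneg_left h2 (Nat.cast_nonneg (α := ℝ) c)
  have h4 := mul_le_mul_of_nonneg_left h1 (by positivity : (0 : ℝ) ≤ c + 1)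
  linarith

theorem winLoss_strictMono (x y : ℝ) : StrictMono (winLoss A B c x y) := fun q q' h => by
  have := winLoss_add_le hA hB c (x := x) (y := y) h.le
  linarith

theorem continuous_winLoss (q : ℝ) :
    Continuous fun z : ℝ × ℝ => winLoss A B c z.1 z.2 q := by
  unfold winLoss
  have h1 : Continuous fun z : ℝ × ℝ => B z.1 (z.2 - q) :=
    hB.cont.comp (continuous_fst.prodMk (continuous_snd.sub continuous_const))
  have h2 : Continuous fun z : ℝ × ℝ => A (z.1 - q) z.2 :=
    hA.cont.comp ((continuous_fst.sub continuous_const).prodMk continuous_snd)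
  exact (continuous_const.add (continuous_const.mul h1)).sub (continuous_const.mul h2)

theorem winLoss_zeroOf (x y : ℝ) : winLoss A B c x y (zeroOf (winLoss A B c x y)) = 0 := by
  apply zeroOf_spec
  have hc : Continuous (winLoss A B c x y) := by
    unfold winLoss
    have h1 : Continuous fun q : ℝ => B x (y - q) :=
      hB.cont.comp (continuous_const.prodMk (continuous_const.sub continuous_id))
    have h2 : Continuous fun q : ℝ => A (x - q) y :=
      hA.cont.comp ((continuous_const.sub continuous_id).prodMk continuous_const)
    exact (continuous_id.add (continuous_const.mul h1)).sub (continuous_const.mul h2)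
  -- Slope at least one forces a sign change on `[-a, a]`.
  set a := |winLoss A B c x y 0| with ha
  have h0 : 0 ≤ a := abs_nonneg _
  have h1 := winLoss_add_le hA hB c (x := x) (y := y) h0
  have h2 := winLoss_add_le hA hB c (x := x) (y := y) (neg_nonpos.2 h0)
  have h3 := neg_abs_le (winLoss A B c x y 0)
  have h4 := le_abs_self (winLoss A B c x y 0)
  obtain ⟨q, -, hq⟩ := intermediate_value_Icc (by linarith : -a ≤ a) hc.continuousOn
    (show (0 : ℝ) ∈ Set.Icc _ _ from ⟨by linarith, by linarith⟩)
  exact ⟨q, hq⟩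

theorem lt_zeroOf_iff (x y q : ℝ) :
    q < zeroOf (winLoss A B c x y) ↔ winLoss A B c x y q < 0 := by
  rw [← (winLoss_strictMono hA hB c x y).lt_iff_lt, winLoss_zeroOf hA hB]

theorem zeroOf_lt_iff (x y q : ℝ) :
    zeroOf (winLoss A B c x y) < q ↔ 0 < winLoss A B c x y q := by
  rw [← (winLoss_strictMono hA hB c x y).lt_iff_lt, winLoss_zeroOf hA hB]

/-- The position of the zero relative to a price `a` is the sign of the loss at `a`, which is
continuous in the budgets; so preimages of open rays are open. -/
theorem continuous_stopPrice (n : ℕ) :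
    Continuous fun z : ℝ × ℝ => stopPrice A B n c z.1 z.2 := by
  unfold stopPrice
  refine Continuous.max ?_ (by fun_prop)
  refine OrderTopology.continuous_iff.2 fun a => ⟨?_, ?_⟩
  · have : (fun z : ℝ × ℝ => zeroOf (winLoss A B c z.1 z.2)) ⁻¹' Set.Ioi a =
        {z | winLoss A B c z.1 z.2 a < 0} := by
      ext z; exact lt_zeroOf_iff hA hB c z.1 z.2 a
    rw [this]
    exact isOpen_lt (continuous_winLoss hA hB c a) continuous_const
  · have : (fun z : ℝ × ℝ => zeroOf (winLoss A B c z.1 z.2)) ⁻¹' Set.Iio a =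
        {z | 0 < winLoss A B c z.1 z.2 a} := by
      ext z; exact zeroOf_lt_iff hA hB c z.1 z.2 a
    rw [this]
    exact isOpen_lt continuous_const (continuous_winLoss hA hB c a)

/-- If budget and price rise by the same amount, the first agent keeps the same money after paying,
while the price itself has grown and `B` has not dropped: the second agent now strictly loses by
winning. So the price rises by less than the budget. -/
theorem stopPrice_lt_add (n : ℕ) {x x' : ℝ} (y : ℝ) (h : x < x') :
    stopPrice A B n c x' y < stopPrice A B n c x y + (x' - x) := by
  set p := stopPrice A B n c x y with hp
  have hp1 : zeroOf (winLoss A B c x y) ≤ p := le_max_left _ _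
  have hp2 : y - (c + 1) * x / (n + 1) ≤ p := le_max_right _ _
  refine max_lt ?_ ?_
  · rw [zeroOf_lt_iff hA hB]
    have h1 : 0 ≤ winLoss A B c x y p := by
      rw [← winLoss_zeroOf hA hB c x y]
      exact (winLoss_strictMono hA hB c x y).monotone hp1
    unfold winLoss at h1 ⊢
    have h2 : B x (y - p) ≤ B x' (y - (p + (x' - x))) :=
      ((hB.mono _).monotone h.le).trans (hB.anti x' (by linarith))
    have h3 := mul_le_mul_of_nonneg_left h2 (Nat.cast_nonneg (α := ℝ) c)
    rw [show x' - (p + (x' - x)) = x - p by ring]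
    linarith
  · have : ((c : ℝ) + 1) * x / (n + 1) ≤ (c + 1) * x' / (n + 1) := by gcongr
    linarith

theorem IsMonoAnti.step (n : ℕ) : IsMonoAnti fun x y => A (x - stopPrice A B n c x y) y where
  cont := hA.cont.comp
    ((continuous_fst.sub (continuous_stopPrice hA hB c n)).prodMk continuous_snd)
  mono y x x' h := hA.mono y (by have := stopPrice_lt_add hA hB c n y h; linarith)
  anti x y y' h := by
    show A (x - stopPrice A B n c x y') y' ≤ A (x - stopPrice A B n c x y) y
    rcases le_or_gt (stopPrice A B n c x y) (stopPrice A B n c x y') with hp | hp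
    · exact (hA.anti _ h).trans ((hA.mono y).monotone (by linarith))
    -- The floor rises with the opponent's budget, so a falling price must start from the point of
    -- indifference.
    · have hz : stopPrice A B n c x y = zeroOf (winLoss A B c x y) := by
        refine max_eq_left (le_of_not_gt fun hlt => ?_)
        have h1 : stopPrice A B n c x y = y - (c + 1) * x / (n + 1) := max_eq_right hlt.le
        have h2 : y' - (c + 1) * x / (n + 1) ≤ stopPrice A B n c x y' := le_max_right _ _
        linarith
      set q' := zeroOf (winLoss A B c x y') with hq'
      have hq'p : q' ≤ stopPrice A B n c x y' := le_max_left _ _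
      have e1 := winLoss_zeroOf hA hB c x y
      have e2 := winLoss_zeroOf hA hB c x y'
      rw [← hz] at e1
      rw [← hq'] at e2
      unfold winLoss at e1 e2
      have h3 : A (x - stopPrice A B n c x y') y' ≤ A (x - q') y' :=
        (hA.mono y').monotone (by linarith)
      -- A lower price and a larger budget leave the second agent more after winning, so both terms
      -- of the indifference equation for `(c + 1) * A` go down.
      have h4 : B x (y' - q') ≤ B x (y - stopPrice A B n c x y) := hB.anti x (by linarith)
      have h5 := mul_le_mul_of_nonneg_left h4 (Nat.cast_nonneg (α := ℝ) c)
      have h6 : ((c : ℝ) + 1) * A (x - q') y' ≤ (c + 1) * A (x - stopPrice A B n c x y) y := by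
        linarith
      exact h3.trans (le_of_mul_le_mul_left h6 (by positivity))

end

theorem leftoverFun_isMonoAnti (n c : ℕ) : IsMonoAnti (leftoverFun n c) := by
  induction n generalizing c with
  | zero =>
    refine ⟨?_, fun y x x' h => ?_, fun x y y' h => ?_⟩
    · simp only [leftoverFun_zero]; exact continuous_fst
    · simpa only [leftoverFun_zero] using h
    · simp only [leftoverFun_zero, le_refl]
  | succ n ihn =>
    induction c with
    | zero =>
      refine ⟨?_, fun y x x' h => ?_, fun x y y' h => ?_⟩
      · simp only [leftoverFun_succ_zero]; fun_prop
      · simp only [leftoverFun_succ_zero]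
        exact min_lt_min (by gcongr) (by linarith)
      · simp only [leftoverFun_succ_zero]
        gcongr
    | succ c ihc =>
      have := IsMonoAnti.step (ihn (c + 1)) ihc c n
      simpa only [leftoverFun] using this

/-! ### Bounds on leftovers and first prices -/

theorem firstPrice_ge (n c : ℕ) (x y : ℝ) : y - (c + 1) * x / (n + 1) ≤ firstPrice n c x y :=
  le_max_right _ _

theorem firstPrice_eq_or (n c : ℕ) (x y : ℝ) :
    firstPrice n c x y = y - (c + 1) * x / (n + 1) ∨
      (c + 1) * leftoverFun n (c + 1) (x - firstPrice n c x y) y =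
        firstPrice n c x y + c * leftoverFun (n + 1) c x (y - firstPrice n c x y) := by
  have e := winLoss_zeroOf (leftoverFun_isMonoAnti n (c + 1)) (leftoverFun_isMonoAnti (n + 1) c) c x y
  rcases max_choice (zeroOf (winLoss (leftoverFun n (c + 1)) (leftoverFun (n + 1) c) c x y))
    (y - (c + 1) * x / (n + 1)) with h | h
  · right
    rw [← h] at e
    change winLoss _ _ c x y (firstPrice n c x y) = 0 at e
    unfold winLoss at e
    linarith
  · exact .inl h

theorem lt_of_firstPrice_lt {n c : ℕ} {x y q : ℝ} (h : firstPrice n c x y < q) :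
    (c + 1) * leftoverFun n (c + 1) (x - q) y < q + c * leftoverFun (n + 1) c x (y - q) := by
  have h1 := (zeroOf_lt_iff (leftoverFun_isMonoAnti n (c + 1)) (leftoverFun_isMonoAnti (n + 1) c)
    c x y q).1 ((le_max_left _ _).trans_lt h)
  unfold winLoss at h1
  linarith

theorem leftoverFun_mono {n c : ℕ} {x x' : ℝ} (y : ℝ) (h : x ≤ x') :
    leftoverFun n c x y ≤ leftoverFun n c x' y :=
  ((leftoverFun_isMonoAnti n c).mono y).monotone h

theorem leftoverFun_anti {n c : ℕ} (x : ℝ) {y y' : ℝ} (h : y ≤ y') :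
    leftoverFun n c x y' ≤ leftoverFun n c x y :=
  (leftoverFun_isMonoAnti n c).anti x h

/-- The floor on the first price makes the inequality hold again for the money kept and `n - 1`
items. -/
theorem leftoverFun_nonpos {n c : ℕ} {x y : ℝ} (h : (c + 1) * x ≤ n * y) :
    leftoverFun n c x y ≤ 0 := by
  induction n generalizing c x with
  | zero =>
    rw [leftoverFun_zero]
    push_cast at h
    by_contra! hx
    have : 0 < ((c : ℝ) + 1) * x := by positivity
    linarith
  | succ n ihn =>
    cases c with
    | zero =>
      rw [leftoverFun_succ_zero]
      push_cast at h
      exact (min_le_right _ _).trans (by linarith)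
    | succ c =>
      rw [leftoverFun_succ_succ]
      apply ihn
      have h1 := firstPrice_ge n c x y
      push_cast at h ⊢
      have h2 : x - firstPrice n c x y ≤ x - (y - (c + 1) * x / (n + 1)) := by linarith
      have h3 : x - (y - (c + 1) * x / (n + 1)) = (n + c + 2) * x / (n + 1) - y := by
        field_simp; ring
      have h4 : ((c : ℝ) + 1 + 1) * ((n + c + 2) * x / (n + 1) - y) ≤ n * y := by
        have : ((c : ℝ) + 1 + 1) * ((n + c + 2) * x / (n + 1)) ≤ (n + c + 2) * y := by
          rw [mul_div_assoc', div_le_iff₀ (by positivity)]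
          have := mul_le_mul_of_nonneg_left h (by positivity : (0 : ℝ) ≤ n + c + 2)
          linarith
        linarith
      refine le_trans (mul_le_mul_of_nonneg_left h2 (by positivity)) ?_
      rw [h3]; exact h4

/-- The two bounds need each other: paying at least an equal share leaves at most an equal share,
while a price below the share would contradict the indifference equation one step further on. -/
theorem leftoverFun_le_and_le_firstPrice (n c : ℕ) {x : ℝ} (y : ℝ) (hx : 0 ≤ x) :
    leftoverFun n c x y ≤ x / (n + 1) ∧
      ∀ n' c', n = n' + 1 → c = c' + 1 → x / (n + 1) ≤ firstPrice n' c' x y := by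
  induction n generalizing c x y with
  | zero => exact ⟨by simp [leftoverFun_zero], fun n' c' h => by omega⟩
  | succ n ihn =>
    induction c generalizing x y with
    | zero =>
      refine ⟨?_, fun n' c' _ h => by omega⟩
      rw [leftoverFun_succ_zero]
      refine (min_le_left _ _).trans (le_of_eq ?_)
      push_cast; ring
    | succ c ihc =>
      have key : x / ((n + 1 : ℕ) + 1) ≤ firstPrice n c x y := by
        push_cast
        -- `z` is the equal share; a first price below `z` means that the second agent strictly
        -- loses by winning at `z`.
        obtain ⟨z, rfl⟩ : ∃ z, x = (n + 2) * z := ⟨x / (n + 2), by field_simp⟩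
        have hz : 0 ≤ z := nonneg_of_mul_nonneg_right hx (by positivity)
        rw [show (n + 2) * z / ((n : ℝ) + 1 + 1) = z by field_simp; ring]
        by_contra! hlt
        have h1 := lt_of_firstPrice_lt hlt
        have hb := (firstPrice_ge n c ((n + 2) * z) y).trans_lt hlt
        rw [show ((n : ℝ) + 2) * z - z = (n + 1) * z by ring] at h1
        cases n with
        | zero =>
          rw [leftoverFun_zero] at h1
          have h2 := (ihc (y - z) hx).1
          rw [show ((0 : ℕ) + 2 : ℝ) * z / ((0 + 1 : ℕ) + 1) = z by push_cast; ring] at h2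
          have h3 := mul_le_mul_of_nonneg_left h2 (Nat.cast_nonneg (α := ℝ) c)
          push_cast at h1 h3
          linarith
        | succ m =>
          set r := firstPrice m c (((m + 1 : ℕ) + 1) * z) y with hr
          have hrz : z ≤ r := by
            have := (ihn (c + 1) y (by positivity : 0 ≤ (((m + 1 : ℕ) : ℝ) + 1) * z)).2 m c rfl rfl
            refine le_trans (le_of_eq ?_) this
            field_simp
          rw [leftoverFun_succ_succ, ← hr] at h1
          rcases firstPrice_eq_or m c (((m + 1 : ℕ) + 1) * z) y with hβ | he
          -- The next price `r ≥ z` is at its floor, while the present floor is below `z`; this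
          -- would give `(m + 2) / (m + 1) < (m + 3) / (m + 2)`.
          · rw [← hr] at hβ
            push_cast at hβ hb
            have h4 : ((c : ℝ) + 1) * ((m + 1 + 1) * z) / (m + 1)
                < (c + 1) * ((m + 1 + 2) * z) / (m + 1 + 1) := by linarith
            rw [div_lt_div_iff₀ (by positivity) (by positivity)] at h4
            have : 0 ≤ ((c : ℝ) + 1) * z := by positivity
            nlinarith
          · rw [← hr] at he
            have h5 : leftoverFun (m + 1) c (((m + 1 : ℕ) + 1) * z) (y - z) ≤
              leftoverFun (m + 1) c (((m + 1 : ℕ) + 1) * z) (y - r) :=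
                leftoverFun_anti _ (by linarith)
            have h6 : (c : ℝ) * leftoverFun (m + 1 + 1) c (((m + 1 : ℕ) + 2) * z) (y - z) ≤
                c * leftoverFun (m + 1) c (((m + 1 : ℕ) + 1) * z) (y - z) := by
              cases c with
              | zero => simp
              | succ c =>
                refine mul_le_mul_of_nonneg_left ?_ (Nat.cast_nonneg _)
                have h8 := (ihc (y - z) hx).2 (m + 1) c rfl rfl
                rw [leftoverFun_succ_succ]
                apply leftoverFun_mono
                rw [show (((m + 1 : ℕ) : ℝ) + 2) * z / ((m + 1 + 1 : ℕ) + 1) = z by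
                  push_cast; field_simp; ring] at h8
                push_cast at h8 ⊢
                linarith
            have h7 := mul_le_mul_of_nonneg_left h5 (Nat.cast_nonneg (α := ℝ) c)
            linarith
      refine ⟨?_, fun n' c' h h' => by
        obtain rfl : n = n' := by omega
        obtain rfl : c = c' := by omega
        exact key⟩
      rw [leftoverFun_succ_succ]
      push_cast at key ⊢
      have h0 : 0 ≤ x / ((n : ℝ) + 1 + 1) := by positivity
      rcases le_total (firstPrice n c x y) x with h | h
      · refine (ihn (c + 1) y (sub_nonneg.2 h)).1.trans ?_
        rw [div_le_div_iff₀ (by positivity) (by positivity)]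
        rw [div_le_iff₀ (by positivity)] at key
        linarith
      · refine (leftoverFun_mono y (sub_nonpos.2 h)).trans (le_trans ?_ h0)
        have := (ihn (c + 1) y le_rfl).1
        simpa using this

theorem le_firstPrice (n c : ℕ) {x : ℝ} (y : ℝ) (hx : 0 ≤ x) :
    x / (n + 2) ≤ firstPrice n c x y := by
  have := (leftoverFun_le_and_le_firstPrice (n + 1) (c + 1) y hx).2 n c rfl rfl
  push_cast at this
  rwa [show (n : ℝ) + 2 = n + 1 + 1 by ring]

theorem leftoverFun_le (n c : ℕ) {x : ℝ} (y : ℝ) (hx : 0 ≤ x) :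
    leftoverFun n c x y ≤ x / (n + 1) :=
  (leftoverFun_le_and_le_firstPrice n c y hx).1

/-- At the floor price the remaining budgets satisfy the same strict inequality. Above it,
indifference expresses `(c + 1)` times the leftover as a positive price plus `c` times a leftover
that is nonnegative by induction on `c`. -/
theorem leftoverFun_pos {n c : ℕ} {x y : ℝ} (hx : 0 < x) (h : n * y < (c + 1) * x) :
    0 < leftoverFun n c x y := by
  induction n generalizing c x y with
  | zero => rwa [leftoverFun_zero]
  | succ n ihn =>
    induction c generalizing x y with
    | zero =>
      rw [leftoverFun_succ_zero]
      push_cast at h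
      exact lt_min (by positivity) (by linarith)
    | succ c ihc =>
      rcases (firstPrice_ge n c x y).eq_or_lt with hβ | hlt
      · rw [leftoverFun_succ_succ, ← hβ]
        push_cast at h
        have h3 : x - (y - (c + 1) * x / (n + 1)) = (n + c + 2) * x / (n + 1) - y := by
          field_simp; ring
        have h4 : y < (c + 1 + 1) * x / (n + 1) := by
          rw [lt_div_iff₀ (by positivity)]; linarith
        have h5 : ((n : ℝ) + c + 2) * x / (n + 1)
            = (c + 1 + 1) * x / (n + 1) + n * (x / (n + 1)) := by
          field_simp; ring
        rw [h3]
        apply ihn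
        · have : 0 ≤ (n : ℝ) * (x / (n + 1)) := by positivity
          linarith
        · have h6 : ((c : ℝ) + 1 + 1) * ((n + c + 2) * x / (n + 1))
              = (n + c + 2) * ((c + 1 + 1) * x / (n + 1)) := by ring
          have h7 := mul_lt_mul_of_pos_left h4 (by positivity : (0 : ℝ) < n + c + 2)
          push_cast
          linarith
      · have he := (firstPrice_eq_or n c x y).resolve_left hlt.ne'
        rw [← leftoverFun_succ_succ] at he
        have hq := (by positivity : 0 < x / ((n : ℝ) + 2)).trans_le (le_firstPrice n c y hx.le)
        have hs : 0 ≤ leftoverFun (n + 1) c x (y - firstPrice n c x y) := by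
          by_contra! hneg
          refine hneg.not_gt (ihc hx ?_)
          rw [sub_lt_comm, lt_div_iff₀ (by positivity)] at hlt
          push_cast
          linarith
        have h1 : 0 < ((c : ℝ) + 1) * leftoverFun (n + 1) (c + 1) x y := by
          rw [he]; positivity
        exact pos_of_mul_pos_right h1 (by positivity)

/-- At the upper boundary and beyond, the equal share solves every indifference equation: price and
both continuation leftovers coincide with it. -/
theorem leftoverFun_eq {n c : ℕ} {x y : ℝ} (hx : 0 ≤ x) (h : (n + 1) * y ≤ (c + 1) * x) :
    leftoverFun n c x y = x / (n + 1) := by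
  induction n generalizing c x y with
  | zero => simp [leftoverFun_zero]
  | succ n ihn =>
    induction c generalizing x y with
    | zero =>
      rw [leftoverFun_succ_zero, min_eq_left]
      · push_cast; ring
      · push_cast at h
        rw [div_le_iff₀ (by positivity)]
        nlinarith
    | succ c ihc =>
      push_cast at h ⊢
      obtain ⟨z, rfl⟩ : ∃ z, x = (n + 2) * z := ⟨x / (n + 2), by field_simp⟩
      have hz : 0 ≤ z := nonneg_of_mul_nonneg_right hx (by positivity)
      have hzx : (n + 2) * z / ((n : ℝ) + 1 + 1) = z := by field_simp; ring
      have hy : y ≤ (c + 2) * z := by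
        have : ((n : ℝ) + 2) * y ≤ (n + 2) * ((c + 2) * z) := by linarith
        exact le_of_mul_le_mul_left this (by positivity)
      have h1 : leftoverFun n (c + 1) ((n + 2) * z - z) y = z := by
        rw [ihn (by nlinarith) ?_]
        · field_simp; ring
        · push_cast; nlinarith [mul_le_mul_of_nonneg_left hy (by positivity : (0 : ℝ) ≤ n + 1)]
      have h2 : leftoverFun (n + 1) c ((n + 2) * z) (y - z) = z := by
        rw [ihc hx ?_]
        · push_cast; exact hzx
        · push_cast; nlinarith
      have hA := leftoverFun_isMonoAnti n (c + 1)
      have hB := leftoverFun_isMonoAnti (n + 1) c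
      have h3 : zeroOf (winLoss (leftoverFun n (c + 1)) (leftoverFun (n + 1) c) c
          ((n + 2) * z) y) = z := by
        apply (winLoss_strictMono hA hB c ((n + 2) * z) y).injective
        rw [winLoss_zeroOf hA hB, winLoss, h1, h2]
        ring
      have h4 : firstPrice n c ((n + 2) * z) y = z := by
        rw [firstPrice, stopPrice, h3, max_eq_left]
        have : ((c : ℝ) + 1) * z ≤ (c + 1) * ((n + 2) * z) / (n + 1) := by
          rw [le_div_iff₀ (by positivity)]
          have : 0 ≤ ((c : ℝ) + 1) * z := by positivity
          nlinarith
        linarith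
      rw [leftoverFun_succ_succ, h4, h1, hzx]

/-! ### The region of a split, and its invariance under a round at the first price -/

/-- The budgets for which an agent with budget `x` is to win `n` items against an opponent with
budget `y` who wins `c` items, and has at most as much money per item that she competes for. -/
structure IsSplit (n c : ℕ) (x y : ℝ) : Prop where
  nonneg : 0 ≤ x
  pos : 0 < y
  lower : n ≠ 0 → n * y < (c + 1) * x
  upper : (c + 1) * x ≤ (n + 1) * y

theorem leftoverFun_sub_le (n c : ℕ) (y : ℝ) {x q : ℝ} (hq : x / (n + 2) ≤ q) (hqx : q ≤ x) :
    leftoverFun n (c + 1) (x - q) y ≤ x / (n + 2) := by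
  refine (leftoverFun_le n (c + 1) y (sub_nonneg.2 hqx)).trans ?_
  rw [div_le_iff₀ (by positivity)] at hq ⊢
  have : x / (n + 2) * (n + 1) = x - x / (n + 2) := by field_simp; ring
  rw [this, sub_le_sub_iff_left, div_le_iff₀ (by positivity)]
  exact hq

/-- A second agent who wins at the floor price moves the budgets exactly to the lower boundary of
the next region. -/
theorem leftoverFun_firstPrice_nonpos {n c : ℕ} {x y : ℝ}
    (he : firstPrice n c x y = y - (c + 1) * x / (n + 1)) :
    leftoverFun (n + 1) c x (y - firstPrice n c x y) ≤ 0 := by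
  apply leftoverFun_nonpos
  rw [he]
  apply le_of_eq
  push_cast
  field_simp
  ring

section
variable {n c : ℕ} {x y : ℝ} (h : IsSplit (n + 1) (c + 1) x y)
include h

theorem IsSplit.pos_left : 0 < x := by
  have h1 := h.lower (by simp)
  have h2 : (0 : ℝ) ≤ (n + 1 : ℕ) * y := mul_nonneg (Nat.cast_nonneg _) h.pos.le
  exact pos_of_mul_pos_right (h2.trans_lt h1) (by positivity)

theorem IsSplit.leftoverFun_pos : 0 < leftoverFun (n + 1) (c + 1) x y :=
  _root_.leftoverFun_pos h.pos_left (h.lower (by simp))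

theorem IsSplit.div_le : x / (n + 2) ≤ y - (c + 1) * x / (n + 2) := by
  have := h.upper
  push_cast at this
  rw [le_sub_iff_add_le, ← add_div, div_le_iff₀ (by positivity)]
  linarith

theorem IsSplit.leftoverFun_eq_of_le {q : ℝ} (hq : y - (c + 1) * x / (n + 2) ≤ q) :
    leftoverFun (n + 1) c x (y - q) = x / (n + 2) := by
  rw [leftoverFun_eq h.nonneg]
  · push_cast; ring
  · have : y - q ≤ (c + 1) * x / (n + 2) := by linarith
    rw [le_div_iff₀ (by positivity)] at this
    push_cast; linarith

theorem IsSplit.leftoverFun_sub_firstPrice_pos :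
    0 < leftoverFun n (c + 1) (x - firstPrice n c x y) y := by
  rw [← leftoverFun_succ_succ]; exact h.leftoverFun_pos

theorem IsSplit.mul_lt_firstPrice : n * y < (c + 2) * (x - firstPrice n c x y) := by
  by_contra! hle
  refine h.leftoverFun_sub_firstPrice_pos.not_ge (leftoverFun_nonpos ?_)
  push_cast; linarith

theorem IsSplit.firstPrice_lt : firstPrice n c x y < x := by
  have h1 : (0 : ℝ) ≤ n * y := mul_nonneg (Nat.cast_nonneg _) h.pos.le
  have := pos_of_mul_pos_right (h1.trans_lt h.mul_lt_firstPrice) (by positivity)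
  linarith

theorem IsSplit.lower_lt_upper : y - (c + 1) * x / (n + 1) < y - (c + 1) * x / (n + 2) := by
  have hx := h.pos_left
  apply sub_lt_sub_left
  apply div_lt_div_of_pos_left (by positivity) (by positivity)
  linarith

/-- Above this price `B` would have the constant value `x / (n + 2)`; as `A` is at most that,
indifference would bound the price by `x / (n + 2)`, which is no larger than the asserted bound. -/
theorem IsSplit.firstPrice_le : firstPrice n c x y ≤ y - (c + 1) * x / (n + 2) := by
  by_contra! hlt
  have h1 := (firstPrice_eq_or n c x y).resolve_left (h.lower_lt_upper.trans hlt).ne'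
  rw [h.leftoverFun_eq_of_le hlt.le] at h1
  have h2 := leftoverFun_sub_le n c y (le_firstPrice n c y h.nonneg) h.firstPrice_lt.le
  have h3 := mul_le_mul_of_nonneg_left h2 (by positivity : (0 : ℝ) ≤ c + 1)
  have h4 := h.div_le
  linarith

theorem IsSplit.firstPrice_lt_of_lt
    (hlt : leftoverFun (n + 1) c x (y - firstPrice n c x y) <
      leftoverFun n (c + 1) (x - firstPrice n c x y) y) :
    firstPrice n c x y < y - (c + 1) * x / (n + 2) := by
  refine lt_of_le_of_ne h.firstPrice_le fun he => ?_
  rw [h.leftoverFun_eq_of_le he.ge] at hlt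
  exact hlt.not_ge (leftoverFun_sub_le n c y (le_firstPrice n c y h.nonneg) h.firstPrice_lt.le)

/-- With `A ≤ B`, the equation `(c + 1) * A = P + c * B` gives `P ≤ B`; but `B ≤ x / (n + 2) ≤ P`,
so everything coincides. This is the only case in which the first agent does not strictly prefer to
win at `P`. -/
theorem IsSplit.firstPrice_eq_of_le
    (hle : leftoverFun n (c + 1) (x - firstPrice n c x y) y ≤
      leftoverFun (n + 1) c x (y - firstPrice n c x y)) :
    y - (c + 1) * x / (n + 1) < firstPrice n c x y ∧
      leftoverFun (n + 1) c x (y - firstPrice n c x y) = firstPrice n c x y ∧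
      leftoverFun n (c + 1) (x - firstPrice n c x y) y = firstPrice n c x y := by
  have hβ : y - (c + 1) * x / (n + 1) < firstPrice n c x y := by
    refine (firstPrice_ge n c x y).lt_of_ne fun he => ?_
    exact (h.leftoverFun_sub_firstPrice_pos.trans_le hle).not_ge
      (leftoverFun_firstPrice_nonpos he.symm)
  have h1 := (firstPrice_eq_or n c x y).resolve_left hβ.ne'
  have h2 := le_firstPrice n c y h.nonneg
  have h3 := leftoverFun_le (n + 1) c (y - firstPrice n c x y) h.nonneg
  push_cast at h3
  rw [show (n : ℝ) + 1 + 1 = n + 2 by ring] at h3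
  have h4 := mul_le_mul_of_nonneg_left hle (by positivity : (0 : ℝ) ≤ c + 1)
  have h5 : leftoverFun (n + 1) c x (y - firstPrice n c x y) = firstPrice n c x y := by linarith
  refine ⟨hβ, h5, ?_⟩
  rw [h5] at h1
  have h6 : ((c : ℝ) + 1) * leftoverFun n (c + 1) (x - firstPrice n c x y) y
      = (c + 1) * firstPrice n c x y := by linarith
  exact mul_left_cancel₀ (by positivity) h6

/-- After the first agent has won at a price at least the first price. -/
theorem IsSplit.win {q : ℝ} (hq : firstPrice n c x y ≤ q) (hqx : n * y < (c + 2) * (x - q)) :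
    IsSplit n (c + 1) (x - q) y where
  nonneg := by
    have h1 : (0 : ℝ) ≤ n * y := mul_nonneg (Nat.cast_nonneg _) h.pos.le
    exact (pos_of_mul_pos_right (h1.trans_lt hqx) (by positivity)).le
  pos := h.pos
  lower _ := by push_cast; linarith
  upper := by
    have h1 := (le_firstPrice n c y h.nonneg).trans hq
    have h2 := h.upper
    push_cast at h2 ⊢
    have h3 : x - q ≤ (n + 1) * (x / (n + 2)) := by
      have : x / (n + 2) * (n + 1) = x - x / (n + 2) := by field_simp; ring
      linarith
    have h4 : x / ((n : ℝ) + 2) * (c + 1 + 1) ≤ y := by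
      rw [div_mul_eq_mul_div, div_le_iff₀ (by positivity)]; linarith
    have h5 := mul_le_mul_of_nonneg_left h3 (by positivity : (0 : ℝ) ≤ c + 1 + 1)
    have h6 := mul_le_mul_of_nonneg_left h4 (by positivity : (0 : ℝ) ≤ n + 1)
    linarith

/-- After the second agent has won. -/
theorem IsSplit.lose {q : ℝ} (hq : y - (c + 1) * x / (n + 1) < q)
    (hq' : q ≤ y - (c + 1) * x / (n + 2)) : IsSplit (n + 1) c x (y - q) where
  nonneg := h.nonneg
  pos := by
    have hx := h.pos_left
    have : 0 < ((c : ℝ) + 1) * x / (n + 2) := by positivity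
    linarith
  lower _ := by
    have : y - q < (c + 1) * x / (n + 1) := by linarith
    rw [lt_div_iff₀ (by positivity)] at this
    push_cast; linarith
  upper := by
    have : (c + 1) * x / (n + 2) ≤ y - q := by linarith
    rw [div_le_iff₀ (by positivity)] at this
    push_cast; linarith

end

/-! ### One round of the canonical outcome -/

theorem opponent_ne (i : Agent) : opponent i ≠ i := by
  fin_cases i <;> decide

theorem opponent_opponent (i : Agent) : opponent (opponent i) = i := by
  fin_cases i <;> decide

theorem eq_or_eq_opponent (i j : Agent) : j = i ∨ j = opponent i := by
  fin_cases i <;> fin_cases j <;> decide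

theorem budgets_self (i : Agent) (x y : ℝ) : budgets i x y i = x := by
  simp [budgets]

theorem budgets_opponent (i : Agent) (x y : ℝ) : budgets i x y (opponent i) = y := by
  simp [budgets, opponent_ne]

theorem budgets_swap (i : Agent) (x y : ℝ) : budgets (opponent i) y x = budgets i x y := by
  funext j
  rcases eq_or_eq_opponent i j with rfl | rfl
  · have := (opponent_ne j).symm
    simp [budgets, this]
  · simp [budgets, opponent_ne]

theorem charge_budgets (i : Agent) (x y p : ℝ) :
    charge (budgets i x y) i p = budgets i (x - p) y := by
  funext j
  rcases eq_or_eq_opponent i j with rfl | rfl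
  · simp [charge, budgets]
  · simp [charge, budgets, opponent_ne]

theorem charge_budgets_opponent (i : Agent) (x y p : ℝ) :
    charge (budgets i x y) (opponent i) p = budgets i x (y - p) := by
  rw [← budgets_swap, charge_budgets, budgets_swap]

theorem budgets_eta (i : Agent) (B : Agent → ℝ) : budgets i (B i) (B (opponent i)) = B := by
  funext j
  rcases eq_or_eq_opponent i j with rfl | rfl
  · simp [budgets]
  · simp [budgets, opponent_ne]

/-- Expected canonical utility of agent `i` with budget `x` against budget `y`. -/
noncomputable def util (v : Agent → ℝ) (k : ℕ) (i : Agent) (x y : ℝ) : ℝ :=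
  canonicalUtility v k (budgets i x y) i

theorem util_opponent (v : Agent → ℝ) (k : ℕ) (i : Agent) (x y : ℝ) :
    util v k (opponent i) y x = canonicalUtility v k (budgets i x y) (opponent i) := by
  rw [util, budgets_swap]

theorem util_zero (v : Agent → ℝ) (i : Agent) (x y : ℝ) : util v 0 i x y = x := by
  simp [util, canonicalUtility, canonicalOutcome, AuctionResult.utility, budgets]

/-- `p` is the critical price of agent `i` with budget `x` against budget `y`, when `k` items
follow. -/
def IsCrit (v : Agent → ℝ) (k : ℕ) (i : Agent) (x y p : ℝ) : Prop :=
  IsCriticalPrice v (canonicalUtility v k) i (budgets i x y) p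

theorem winningUtility_eq (v : Agent → ℝ) (k : ℕ) (i : Agent) (x y q : ℝ) :
    winningUtility v (canonicalUtility v k) i (budgets i x y) q = v i + util v k i (x - q) y := by
  rw [winningUtility, charge_budgets, util]

theorem losingUtility_eq (v : Agent → ℝ) (k : ℕ) (i : Agent) (x y q : ℝ) :
    losingUtility (canonicalUtility v k) i (budgets i x y) q = util v k i x (y - min q y) := by
  rw [losingUtility, charge_budgets_opponent, util, budgets_opponent]

theorem isCrit_iff (v : Agent → ℝ) (k : ℕ) (i : Agent) (x y p : ℝ) :
    IsCrit v k i x y p ↔ p ∈ Set.Icc 0 x ∧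
      (∀ q ∈ Set.Icc 0 x, p < q → v i + util v k i (x - q) y < util v k i x (y - min q y)) ∧
      (∀ q ∈ Set.Icc 0 x, q < p → util v k i x (y - min q y) < v i + util v k i (x - q) y) := by
  simp only [IsCrit, IsCriticalPrice, winningUtility_eq, losingUtility_eq, budgets_self]

theorem expect_fin_succ_agent (k : ℕ) (f : (Fin (k + 1) → Agent) → ℝ) :
    Finset.univ.expect f =
      Finset.univ.expect fun c : Agent => Finset.univ.expect fun ω : Fin k → Agent =>
        f (Fin.cons c ω) := by
  rw [← Finset.expect_product']
  exact (Fintype.expect_equiv (Fin.consEquiv fun _ => Agent) _ _ fun _ => rfl).symm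

/-- The bids in the first round of the auction with `k + 1` items. -/
noncomputable def firstBids (v : Agent → ℝ) (k : ℕ) (B : Agent → ℝ) : Agent → Bid :=
  canonicalBids (reservePrice v k (canonicalUtility v k) B)

theorem canonicalUtility_succ (v : Agent → ℝ) (k : ℕ) (B : Agent → ℝ) (i : Agent) :
    canonicalUtility v (k + 1) B i = Finset.univ.expect fun c : Agent =>
      (if i = roundWinner (firstBids v k B) c then v i else 0) +
        canonicalUtility v k (charge B (roundWinner (firstBids v k B) c)
          (firstBids v k B (roundWinner (firstBids v k B) c)).price) i := by
  rw [canonicalUtility, expect_fin_succ_agent]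
  refine Finset.expect_congr rfl fun c _ => ?_
  rw [canonicalUtility, ← Finset.expect_const (s := (Finset.univ : Finset (Fin k → Agent)))
    Finset.univ_nonempty (if i = roundWinner (firstBids v k B) c then v i else 0),
    ← Finset.expect_add_distrib]
  refine Finset.expect_congr rfl fun ω _ => ?_
  simp only [canonicalOutcome, AuctionResult.utility, Fin.cons_zero, Fin.tail_cons]
  change v i * (((if i = roundWinner (firstBids v k B) c then 1 else 0) + _ : ℕ) : ℝ) + _ = _
  push_cast
  rw [mul_add, mul_ite, mul_one, mul_zero, add_assoc]
  rfl

theorem roundWinner_of_lt {b : Agent → Bid} {i : Agent} (h : b (opponent i) < b i) (c : Agent) :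
    roundWinner b c = i := by
  fin_cases i
  · exact if_pos h
  · change b 0 < b 1 at h
    rw [roundWinner, if_neg h.not_gt, if_pos h]
    rfl

theorem roundWinner_of_eq {b : Agent → Bid} {i : Agent} (h : b (opponent i) = b i) (c : Agent) :
    roundWinner b c = c := by
  have h' : b 0 = b 1 := by
    fin_cases i
    · exact h.symm
    · exact h
  rw [roundWinner, h', if_neg (lt_irrefl _), if_neg (lt_irrefl _)]

theorem expect_agent (f : Agent → ℝ) (i : Agent) :
    Finset.univ.expect f = (f i + f (opponent i)) / 2 := by
  rw [Fintype.expect_eq_sum_div_card, Fin.sum_univ_two, Fintype.card_fin]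
  fin_cases i
  · norm_num [opponent]
  · norm_num [opponent, add_comm]

section
variable {v : Agent → ℝ} {k : ℕ} {i : Agent} {x y p p' : ℝ}

theorem util_succ_of_lt
    (hi : reservePrice v k (canonicalUtility v k) (budgets i x y) i = p)
    (ho : reservePrice v k (canonicalUtility v k) (budgets i x y) (opponent i) = p')
    (hlt : p' < p) :
    util v (k + 1) i x y = v i + util v k i (x - p') y ∧
      util v (k + 1) (opponent i) y x = util v k (opponent i) y (x - p') := by
  have b1 : firstBids v k (budgets i x y) i = plusBid p' := by
    rw [firstBids, canonicalBids, hi, ho, if_pos hlt]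
  have b2 : firstBids v k (budgets i x y) (opponent i) = plainBid p' := by
    rw [firstBids, canonicalBids, opponent_opponent, hi, ho, if_neg hlt.not_gt]
  have hw : ∀ c, roundWinner (firstBids v k (budgets i x y)) c = i :=
    roundWinner_of_lt (by
      rw [b1, b2, plainBid, plusBid, Prod.Lex.toLex_lt_toLex]
      exact .inr ⟨rfl, Bool.false_lt_true⟩)
  have hp : (plusBid p').price = p' := rfl
  constructor
  · rw [util, canonicalUtility_succ]
    simp only [hw, b1, hp, if_true, charge_budgets]
    rw [Finset.expect_const Finset.univ_nonempty, util]
  · rw [util_opponent, util_opponent, canonicalUtility_succ]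
    simp only [hw, b1, hp, if_neg (opponent_ne i), charge_budgets, zero_add]
    rw [Finset.expect_const Finset.univ_nonempty]

theorem util_succ_of_eq
    (hi : reservePrice v k (canonicalUtility v k) (budgets i x y) i = p)
    (ho : reservePrice v k (canonicalUtility v k) (budgets i x y) (opponent i) = p) :
    util v (k + 1) i x y = (v i + util v k i (x - p) y + util v k i x (y - p)) / 2 := by
  have b1 : firstBids v k (budgets i x y) i = plainBid p := by
    rw [firstBids, canonicalBids, hi, ho, if_neg (lt_irrefl _)]
  have b2 : firstBids v k (budgets i x y) (opponent i) = plainBid p := by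
    rw [firstBids, canonicalBids, opponent_opponent, hi, ho, if_neg (lt_irrefl _)]
  have hw : ∀ c, roundWinner (firstBids v k (budgets i x y)) c = c :=
    roundWinner_of_eq (b2.trans b1.symm)
  have hp : (plainBid p).price = p := rfl
  rw [util, canonicalUtility_succ, expect_agent _ i]
  simp only [hw, b1, b2, hp, if_true, if_neg (opponent_ne i).symm, charge_budgets,
    charge_budgets_opponent, zero_add, util]

end

/-! ### The standing assumption and the form of the utilities -/

/-- Budgets `x`, `y` in the auction with `k` items to which the standing assumption applies. -/
structure Dominated (v : Agent → ℝ) (k : ℕ) (x y : ℝ) : Prop where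
  left_nonneg : 0 ≤ x
  right_nonneg : 0 ≤ y
  left_lt : ∀ j, 2 ^ k * x < v j
  right_lt : ∀ j, 2 ^ k * y < v j

theorem valuesDominate_budgets_iff (v : Agent → ℝ) (k : ℕ) (i : Agent) (x y : ℝ) :
    ValuesDominate k v (budgets i x y) ↔ Dominated v k x y := by
  constructor
  · rintro ⟨h0, h⟩
    have h1 := h0 i
    have h2 := h0 (opponent i)
    have h3 := fun j => h j i
    have h4 := fun j => h j (opponent i)
    simp only [budgets_self, budgets_opponent] at h1 h2 h3 h4
    exact ⟨h1, h2, h3, h4⟩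
  · rintro ⟨h1, h2, h3, h4⟩
    refine ⟨fun j => ?_, fun l j => ?_⟩ <;> rcases eq_or_eq_opponent i j with rfl | rfl
    · rwa [budgets_self]
    · rwa [budgets_opponent]
    · rw [budgets_self]; exact h3 l
    · rw [budgets_opponent]; exact h4 l

namespace Dominated
variable {v : Agent → ℝ} {k : ℕ} {x y x' y' : ℝ}

theorem symm (h : Dominated v k x y) : Dominated v k y x :=
  ⟨h.right_nonneg, h.left_nonneg, h.right_lt, h.left_lt⟩

theorem anti (h : Dominated v k x y) (hx : 0 ≤ x') (hx' : x' ≤ x) (hy : 0 ≤ y') (hy' : y' ≤ y) :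
    Dominated v k x' y' where
  left_nonneg := hx
  right_nonneg := hy
  left_lt j := (mul_le_mul_of_nonneg_left hx' (by positivity)).trans_lt (h.left_lt j)
  right_lt j := (mul_le_mul_of_nonneg_left hy' (by positivity)).trans_lt (h.right_lt j)

theorem lt_value (h : Dominated v k x y) (j : Agent) : x < v j := by
  refine lt_of_le_of_lt ?_ (h.left_lt j)
  exact le_mul_of_one_le_left h.left_nonneg (one_le_pow₀ one_le_two)

theorem value_pos (h : Dominated v k x y) (j : Agent) : 0 < v j :=
  h.left_nonneg.trans_lt (h.lt_value j)

theorem of_succ (h : Dominated v (k + 1) x y) : Dominated v k x y where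
  left_nonneg := h.left_nonneg
  right_nonneg := h.right_nonneg
  left_lt j := lt_of_le_of_lt (mul_le_mul_of_nonneg_right
    (pow_le_pow_right₀ one_le_two k.le_succ) h.left_nonneg) (h.left_lt j)
  right_lt j := lt_of_le_of_lt (mul_le_mul_of_nonneg_right
    (pow_le_pow_right₀ one_le_two k.le_succ) h.right_nonneg) (h.right_lt j)

end Dominated

/-- The form of the canonical utilities with `k` items. -/
structure UtilityForm (v : Agent → ℝ) (k : ℕ) : Prop where
  all : ∀ i x y, Dominated v k x y → k * y < x →
    util v k i x y = k * v i + (x - k * y) ∧ util v k (opponent i) y x = y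
  split : ∀ i n c x y, n + c = k → Dominated v k x y → IsSplit n c x y →
    util v k i x y = n * v i + leftoverFun n c x y ∧
      util v k (opponent i) y x = c * v (opponent i) + (y - c * leftoverFun n c x y)
  balanced : ∀ (i : Agent) (j d : ℕ) (z : ℝ), j + d = k → 0 < z →
    Dominated v k ((j + 1) * z) (d * z) → d ≠ 0 →
    j * v i + v i / 2 ^ k ≤ util v k i ((j + 1) * z) (d * z) ∧
      util v k i ((j + 1) * z) (d * z) ≤ (j + 1) * v i
  origin : ∀ i, Dominated v k 0 0 → 0 ≤ util v k i 0 0 ∧ util v k i 0 0 ≤ k * v i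

/-- Monotonicity of the canonical utilities with `k` items. -/
structure UtilityMono (v : Agent → ℝ) (k : ℕ) : Prop where
  own : ∀ i x x' y, Dominated v k x' y → 0 ≤ x → x < x' → util v k i x y < util v k i x' y
  opp : ∀ i x y y', Dominated v k x y' → 0 ≤ y → y ≤ y' → util v k i x y' ≤ util v k i x y

/-- Take the largest `n` with `n * (x + y) < (k + 1) * x`. With `c = k - n` this is the first
inequality, and maximality is the second, equality being the balanced case. -/
theorem exists_split (k : ℕ) {x y : ℝ} (hx : 0 < x) (hy : 0 < y) :
    ∃ n c : ℕ, n + c = k ∧ n * y < (c + 1) * x ∧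
      (c * x < (n + 1) * y ∨ c ≠ 0 ∧ c * x = (n + 1) * y) := by
  classical
  let P : ℕ → Prop := fun n => n * (x + y) < (k + 1) * x
  have h0 : P 0 := by simp only [P]; push_cast; rw [zero_mul]; positivity
  set n := Nat.findGreatest P k with hn
  have hnP : P n := Nat.findGreatest_spec (Nat.zero_le k) h0
  have hnk : n ≤ k := Nat.findGreatest_le k
  have hck : ((k - n : ℕ) : ℝ) = k - n := by push_cast [hnk]; ring
  refine ⟨n, k - n, by omega, ?_, ?_⟩
  · simp only [P] at hnP; rw [hck]; linarith
  · rcases hnk.eq_or_lt with h | h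
    · left
      rw [h]; simp only [Nat.sub_self, Nat.cast_zero, zero_mul]; positivity
    · have h1 : ¬ P (n + 1) := Nat.findGreatest_is_greatest (P := P) (n := k) (by omega) (by omega)
      simp only [P] at h1
      push_cast at h1
      rw [hck]
      rcases (not_lt.1 h1).eq_or_lt with h2 | h2
      · right; exact ⟨by omega, by linarith⟩
      · left; linarith

/-! ### Monotonicity deduced from the form -/

namespace UtilityForm
variable {v : Agent → ℝ} {k : ℕ} (F : UtilityForm v k)
include F

theorem none {x y : ℝ} (i : Agent) (hd : Dominated v k x y) (h : k * x < y) :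
    util v k i x y = x := by
  have := (F.all (opponent i) y x hd.symm h).2
  rwa [opponent_opponent] at this

theorem split_opponent {n c : ℕ} {x y : ℝ} (i : Agent) (hk : n + c = k) (hd : Dominated v k x y)
    (h : IsSplit c n y x) : util v k i x y = n * v i + (x - n * leftoverFun c n y x) := by
  have := (F.split (opponent i) c n y x (by omega) hd.symm h).2
  rwa [opponent_opponent] at this

/-- Between two balanced budgets, the utility is the value of a fixed number of items plus some
part of the budget. -/
theorem open_bounds {n c : ℕ} {x y : ℝ} (i : Agent) (hk : n + c = k) (hd : Dominated v k x y)
    (hx : 0 < x) (hy : 0 < y) (h1 : n * y < (c + 1) * x) (h2 : c * x < (n + 1) * y) :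
    n * v i < util v k i x y ∧ util v k i x y ≤ n * v i + x := by
  rcases le_total ((c + 1) * x) ((n + 1) * y) with h | h
  · have hs : IsSplit n c x y := ⟨hx.le, hy, fun _ => h1, h⟩
    rw [(F.split i n c x y hk hd hs).1]
    have h3 := leftoverFun_pos hx h1
    have h4 := leftoverFun_le n c y hx.le
    have h5 : x / ((n : ℝ) + 1) ≤ x :=
      div_le_self hx.le (by linarith [Nat.cast_nonneg (α := ℝ) n])
    exact ⟨by linarith, by linarith⟩
  · have hs : IsSplit c n y x := ⟨hy.le, hx, fun _ => h2, h⟩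
    rw [F.split_opponent i hk hd hs]
    have h3 := leftoverFun_pos hy h2
    have h4 := leftoverFun_le c n x hy.le
    have h5 : (n : ℝ) * leftoverFun c n y x ≤ n * (y / (c + 1)) := by gcongr
    have h6 : (n : ℝ) * (y / (c + 1)) < x := by
      rw [mul_div_assoc', div_lt_iff₀ (by positivity)]; linarith
    have h7 : 0 ≤ (n : ℝ) * leftoverFun c n y x := by positivity
    exact ⟨by linarith, by linarith⟩

theorem balanced_bounds {n c : ℕ} {x y : ℝ} (i : Agent) (hk : n + c = k) (hd : Dominated v k x y)
    (hx : 0 < x) (hc : c ≠ 0) (h : c * x = (n + 1) * y) :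
    n * v i + v i / 2 ^ k ≤ util v k i x y ∧ util v k i x y ≤ (n + 1) * v i := by
  have e1 : x = (n + 1) * (x / (n + 1)) := by field_simp
  have e2 : y = c * (x / (n + 1)) := by field_simp; linarith
  have := F.balanced i n c (x / (n + 1)) hk (by positivity) (by rwa [← e1, ← e2]) hc
  rwa [← e1, ← e2] at this

/-- One inequality already forces the actual split to give the agent at least `n` items, whichever
case of the form applies. -/
theorem lt_util {n c : ℕ} {x y : ℝ} (i : Agent) (hk : n + c = k) (hd : Dominated v k x y)
    (h : n * y < (c + 1) * x) : n * v i < util v k i x y := by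
  have hv := hd.value_pos i
  have hx : 0 < x := by
    have h1 : (0 : ℝ) ≤ n * y := mul_nonneg (Nat.cast_nonneg _) hd.right_nonneg
    exact pos_of_mul_pos_right (h1.trans_lt h) (by positivity)
  rcases hd.right_nonneg.eq_or_lt with hy | hy
  · subst hy
    rw [(F.all i x 0 hd (by simpa using hx)).1]
    have : (n : ℝ) * v i ≤ k * v i := by
      gcongr; omega
    simp only [mul_zero, sub_zero]
    linarith
  obtain ⟨m, e, hme, h1, h2⟩ := exists_split k hx hy
  have hnm : n ≤ m := by
    by_contra! hlt
    have h3 : ((m : ℝ) + 1) ≤ n := by exact_mod_cast hlt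
    have h4 : (n : ℝ) + c = m + e := by exact_mod_cast hk.trans hme.symm
    have h5 : (e : ℝ) * x ≤ (m + 1) * y := by rcases h2 with h2 | h2; exacts [h2.le, h2.2.le]
    nlinarith
  have h3 : (n : ℝ) * v i ≤ m * v i := by gcongr
  rcases h2 with h2 | ⟨h0, h2⟩
  · exact h3.trans_lt (F.open_bounds i hme hd hx hy h1 h2).1
  · have := (F.balanced_bounds i hme hd hx h0 h2).1
    have : 0 < v i / 2 ^ k := by positivity
    linarith

theorem util_le {n c : ℕ} {x y : ℝ} (i : Agent) (hk : n + c = k) (hd : Dominated v k x y)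
    (h : c * x < (n + 1) * y) : util v k i x y ≤ n * v i + x := by
  have hv := hd.value_pos i
  have hy : 0 < y := by
    have h1 : (0 : ℝ) ≤ c * x := mul_nonneg (Nat.cast_nonneg _) hd.left_nonneg
    exact pos_of_mul_pos_right (h1.trans_lt h) (by positivity)
  rcases hd.left_nonneg.eq_or_lt with hx | hx
  · subst hx
    rw [F.none i hd (by simpa using hy)]
    positivity
  obtain ⟨m, e, hme, h1, h2⟩ := exists_split k hx hy
  have h4 : (n : ℝ) + c = m + e := by exact_mod_cast hk.trans hme.symm
  rcases h2 with h2 | ⟨h0, h2⟩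
  · have hnm : m ≤ n := by
      by_contra! hlt
      have h3 : ((n : ℝ) + 1) ≤ m := by exact_mod_cast hlt
      nlinarith
    have h3 : (m : ℝ) * v i ≤ n * v i := by gcongr
    linarith [(F.open_bounds i hme hd hx hy h1 h2).2]
  · have hnm : m + 1 ≤ n := by
      by_contra! hlt
      have h3 : (n : ℝ) ≤ m := by exact_mod_cast Nat.lt_succ_iff.1 hlt
      nlinarith
    have h3 : ((m : ℝ) + 1) * v i ≤ n * v i := by gcongr; exact_mod_cast hnm
    linarith [(F.balanced_bounds i hme hd hx h0 h2).2]

end UtilityForm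

namespace UtilityForm
variable {v : Agent → ℝ} {k : ℕ} (F : UtilityForm v k)
include F

/-- On either side of `x / (n + 1) = y / (c + 1)` one formula for the leftover applies; when the two
budgets lie on different sides, the bounds on `leftoverFun` separate the values by `x / (n + 1) < x'
/ (n + 1)`. -/
theorem util_lt_of_open {n c : ℕ} {x x' y : ℝ} (i : Agent) (hk : n + c = k)
    (hd : Dominated v k x' y) (hx : 0 < x) (hxx : x < x') (hy : 0 < y)
    (h1 : n * y < (c + 1) * x) (h2 : c * x' < (n + 1) * y) :
    util v k i x y < util v k i x' y := by
  have hd' : Dominated v k x y := hd.anti hx.le hxx.le hy.le le_rfl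
  have hc : (c : ℝ) * x ≤ c * x' := by gcongr
  have h1' : n * y < (c + 1) * x' := by nlinarith
  rcases le_total ((c + 1) * x) ((n + 1) * y) with h | h <;>
    rcases le_total ((c + 1) * x') ((n + 1) * y) with h' | h'
  · rw [(F.split i n c x y hk hd' ⟨hx.le, hy, fun _ => h1, h⟩).1,
      (F.split i n c x' y hk hd ⟨(hx.trans hxx).le, hy, fun _ => h1', h'⟩).1]
    have := (leftoverFun_isMonoAnti n c).mono y hxx
    simp only at this
    linarith
  · rw [(F.split i n c x y hk hd' ⟨hx.le, hy, fun _ => h1, h⟩).1,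
      F.split_opponent i hk hd ⟨hy.le, hx.trans hxx, fun _ => h2, h'⟩]
    have e1 := leftoverFun_le n c y hx.le
    have e2 := leftoverFun_le c n x' hy.le
    have e3 : (n : ℝ) * leftoverFun c n y x' ≤ n * (y / (c + 1)) := by gcongr
    have e4 : y / ((c : ℝ) + 1) ≤ x' / (n + 1) := by
      rw [div_le_div_iff₀ (by positivity) (by positivity)]; linarith
    have e5 : (n : ℝ) * (y / (c + 1)) ≤ n * (x' / (n + 1)) := by gcongr
    have e6 : x' - n * (x' / (n + 1)) = x' / (n + 1) := by field_simp; ring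
    have e7 : x / ((n : ℝ) + 1) < x' / (n + 1) := by gcongr
    linarith
  · exfalso; nlinarith
  · rw [F.split_opponent i hk hd' ⟨hy.le, hx, fun _ => by linarith, h⟩,
      F.split_opponent i hk hd ⟨hy.le, hx.trans hxx, fun _ => h2, h'⟩]
    have e1 : leftoverFun c n y x' ≤ leftoverFun c n y x := leftoverFun_anti y hxx.le
    have e2 : (n : ℝ) * leftoverFun c n y x' ≤ n * leftoverFun c n y x := by gcongr
    linarith

theorem util_le_of_open {n c : ℕ} {x y y' : ℝ} (i : Agent) (hk : n + c = k)
    (hd : Dominated v k x y') (hx : 0 < x) (hyy : y < y') (hy : 0 < y)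
    (h1 : n * y' < (c + 1) * x) (h2 : c * x < (n + 1) * y) :
    util v k i x y' ≤ util v k i x y := by
  have hd' : Dominated v k x y := hd.anti hx.le le_rfl hy.le hyy.le
  have hc : (n : ℝ) * y ≤ n * y' := by gcongr
  have h2' : c * x < (n + 1) * y' := by nlinarith
  rcases le_total ((c + 1) * x) ((n + 1) * y) with h | h <;>
    rcases le_total ((c + 1) * x) ((n + 1) * y') with h' | h'
  · rw [(F.split i n c x y hk hd' ⟨hx.le, hy, fun _ => by linarith, h⟩).1,
      (F.split i n c x y' hk hd ⟨hx.le, hy.trans hyy, fun _ => h1, h'⟩).1]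
    have := leftoverFun_anti (n := n) (c := c) x hyy.le
    linarith
  · exfalso; nlinarith
  · rw [F.split_opponent i hk hd' ⟨hy.le, hx, fun _ => h2, h⟩,
      (F.split i n c x y' hk hd ⟨hx.le, hy.trans hyy, fun _ => h1, h'⟩).1]
    have e1 := leftoverFun_le n c y' hx.le
    have e2 := leftoverFun_le c n x hy.le
    have e3 : (n : ℝ) * leftoverFun c n y x ≤ n * (y / (c + 1)) := by gcongr
    have e4 : y / ((c : ℝ) + 1) ≤ x / (n + 1) := by
      rw [div_le_div_iff₀ (by positivity) (by positivity)]; linarith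
    have e5 : (n : ℝ) * (y / (c + 1)) ≤ n * (x / (n + 1)) := by gcongr
    have e6 : x - n * (x / (n + 1)) = x / (n + 1) := by field_simp; ring
    linarith
  · rw [F.split_opponent i hk hd' ⟨hy.le, hx, fun _ => h2, h⟩,
      F.split_opponent i hk hd ⟨(hy.trans hyy).le, hx, fun _ => h2', h'⟩]
    have e1 : leftoverFun c n y x ≤ leftoverFun c n y' x := leftoverFun_mono x hyy.le
    have e2 : (n : ℝ) * leftoverFun c n y x ≤ n * leftoverFun c n y' x := by gcongr
    linarith

/-- Inside one region only leftovers move. Crossing a boundary changes the item count, and a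
balanced pair lies in between because its extra `v / 2 ^ k` exceeds every admissible budget. -/
theorem mono : UtilityMono v k where
  own i x x' y hd hx hxx := by
    have hd' : Dominated v k x y := hd.anti hx hxx.le hd.right_nonneg le_rfl
    have hx' : 0 < x' := hx.trans_lt hxx
    rcases hx.eq_or_lt with rfl | hx
    · rcases hd.right_nonneg.eq_or_lt with rfl | hy
      · rw [(F.all i x' 0 hd (by simpa using hx')).1]
        have := (F.origin i hd').2
        simp only [mul_zero, sub_zero]
        linarith
      · rw [F.none i hd' (by simpa using hy)]
        have := F.lt_util i (zero_add k) hd (by push_cast; rw [zero_mul]; positivity)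
        simpa using this
    rcases hd.right_nonneg.eq_or_lt with rfl | hy
    · rw [(F.all i x' 0 hd (by simpa using hx')).1, (F.all i x 0 hd' (by simpa using hx)).1]
      linarith
    obtain ⟨n, c, hk, h1, h2⟩ := exists_split k hx hy
    have above (hlt : (n + 1) * y < c * x') : ((n : ℝ) + 1) * v i < util v k i x' y := by
      obtain ⟨e, rfl⟩ : ∃ e, c = e + 1 := by
        refine Nat.exists_eq_succ_of_ne_zero ?_
        rintro rfl
        push_cast at hlt
        have : 0 < ((n : ℝ) + 1) * y := by positivity
        linarith
      have := F.lt_util (n := n + 1) (c := e) i (by omega) hd (by push_cast at hlt ⊢; exact hlt)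
      exact_mod_cast this
    rcases h2 with h2 | ⟨h0, h2⟩
    · rcases lt_trichotomy (c * x') ((n + 1) * y) with h3 | h3 | h3
      · exact F.util_lt_of_open i hk hd hx hxx hy h1 h3
      · have hc : c ≠ 0 := by
          rintro rfl
          have : 0 < ((n : ℝ) + 1) * y := by positivity
          push_cast at h3
          linarith
        have e1 := (F.balanced_bounds i hk hd hx' hc h3).1
        have e2 := (F.open_bounds i hk hd' hx hy h1 h2).2
        have e3 : x' < v i / 2 ^ k := by
          rw [lt_div_iff₀ (by positivity)]; linarith [hd.left_lt i]
        linarith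
      · have e2 := (F.open_bounds i hk hd' hx hy h1 h2).2
        linarith [above h3, hd'.lt_value i]
    · refine (F.balanced_bounds i hk hd' hx h0 h2).2.trans_lt (above ?_)
      rw [← h2]
      gcongr
  opp i x y y' hd hy hyy := by
    have hd' : Dominated v k x y := hd.anti hd.left_nonneg le_rfl hy hyy
    rcases hyy.eq_or_lt with rfl | hyy
    · rfl
    have hy' : 0 < y' := hy.trans_lt hyy
    rcases hd.left_nonneg.eq_or_lt with rfl | hx
    · rw [F.none i hd (by simpa using hy')]
      rcases hy.eq_or_lt with rfl | hy
      · exact (F.origin i hd').1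
      · rw [F.none i hd' (by simpa using hy)]
    rcases hy.eq_or_lt with rfl | hy
    · rw [(F.all i x 0 hd' (by simpa using hx)).1]
      have := F.util_le i (add_zero k) hd (by push_cast; rw [zero_mul]; positivity)
      simpa using this
    obtain ⟨n, c, hk, h1, h2⟩ := exists_split k hx hy
    rcases h2 with h2 | ⟨h0, h2⟩
    · rcases lt_or_ge (n * y') ((c + 1) * x) with h3 | h3
      · exact F.util_le_of_open i hk hd hx hyy hy h3 h2
      · obtain ⟨m, rfl⟩ : ∃ m, n = m + 1 := by
          refine Nat.exists_eq_succ_of_ne_zero ?_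
          rintro rfl
          push_cast at h3
          have : 0 < ((c : ℝ) + 1) * x := by positivity
          linarith
        have e1 := (F.open_bounds i hk hd' hx hy h1 h2).1
        push_cast at e1 h3
        rcases h3.eq_or_lt with h3 | h3
        · have := (F.balanced_bounds (n := m) (c := c + 1) i (by omega) hd hx (by simp)
            (by push_cast; exact h3)).2
          linarith
        · have := F.util_le (n := m) (c := c + 1) i (by omega) hd (by push_cast; exact h3)
          linarith [hd.lt_value i]
    · have e1 := (F.balanced_bounds i hk hd' hx h0 h2).1
      have e2 := F.util_le i hk hd (by rw [h2]; gcongr)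
      have e3 : x < v i / 2 ^ k := by
        rw [lt_div_iff₀ (by positivity)]; linarith [hd.left_lt i]
      linarith

end UtilityForm

/-! ### Critical prices deduced from monotonicity -/

namespace UtilityMono
variable {v : Agent → ℝ} {k : ℕ} (M : UtilityMono v k) {i : Agent} {x y : ℝ}
include M

theorem winning_lt (hd : Dominated v k x y) {q q' : ℝ} (hq : 0 ≤ q) (hqq : q < q') (hq' : q' ≤ x) :
    util v k i (x - q') y < util v k i (x - q) y :=
  M.own i _ _ y (hd.anti (by linarith) (by linarith) hd.right_nonneg le_rfl) (by linarith)
    (by linarith)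

theorem losing_le (hd : Dominated v k x y) {q q' : ℝ} (hq : 0 ≤ q) (hqq : q ≤ q') :
    util v k i x (y - min q y) ≤ util v k i x (y - min q' y) := by
  have h0 : 0 ≤ min q y := le_min hq hd.right_nonneg
  exact M.opp i x _ _ (hd.anti hd.left_nonneg le_rfl (sub_nonneg.2 (min_le_right _ _))
    (by linarith)) (sub_nonneg.2 (min_le_right _ _)) (sub_le_sub_left (min_le_min_right _ hqq) _)

/-- Winning utility strictly decreases in the price and losing utility does not, so they cross once,
at the supremum of the prices where winning is weakly preferred. Utilities jump, so no equality at
the crossing is claimed. -/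
theorem exists_isCrit (hd : Dominated v k x y) (i : Agent) : ∃ p, IsCrit v k i x y p := by
  simp only [isCrit_iff]
  set S : Set ℝ := {q | q ∈ Set.Icc 0 x ∧
    util v k i x (y - min q y) ≤ v i + util v k i (x - q) y} with hS
  have h0 : (0 : ℝ) ∈ S := by
    refine ⟨⟨le_rfl, hd.left_nonneg⟩, ?_⟩
    rw [min_eq_left hd.right_nonneg, sub_zero, sub_zero]
    linarith [hd.value_pos i]
  have hb : BddAbove S := ⟨x, fun q hq => hq.1.2⟩
  refine ⟨sSup S, ⟨le_csSup hb h0, csSup_le ⟨0, h0⟩ fun q hq => hq.1.2⟩, fun q hq hlt => ?_,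
    fun q hq hlt => ?_⟩
  · by_contra! hle
    exact hlt.not_ge (le_csSup hb ⟨hq, hle⟩)
  · obtain ⟨q', hq', hqq⟩ := exists_lt_of_lt_csSup ⟨0, h0⟩ hlt
    have h1 := M.winning_lt (i := i) hd hq.1 hqq hq'.1.2
    have h2 := M.losing_le (i := i) hd hq.1 hqq.le
    linarith [hq'.2]

/-- A price at which the agent weakly prefers to win, and above which she prefers to lose, is
critical. -/
theorem isCrit_of_le (hd : Dominated v k x y) {p : ℝ} (hp : p ∈ Set.Icc 0 x)
    (hle : util v k i x (y - min p y) ≤ v i + util v k i (x - p) y)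
    (hlt : ∀ q ∈ Set.Icc 0 x, p < q →
      v i + util v k i (x - q) y < util v k i x (y - min q y)) : IsCrit v k i x y p := by
  rw [isCrit_iff]
  refine ⟨hp, hlt, fun q hq hqp => ?_⟩
  have h1 := M.winning_lt (i := i) hd hq.1 hqp hp.2
  have h2 := M.losing_le (i := i) hd hq.1 hqp.le
  linarith

theorem isCrit_of_eq (hd : Dominated v k x y) {p : ℝ} (hp : p ∈ Set.Icc 0 x)
    (he : util v k i x (y - min p y) = v i + util v k i (x - p) y) : IsCrit v k i x y p := by
  refine M.isCrit_of_le hd hp he.le fun q hq hpq => ?_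
  have h1 := M.winning_lt (i := i) hd hp.1 hpq hq.2
  have h2 := M.losing_le (i := i) hd hp.1 hpq.le
  linarith

end UtilityMono

theorem IsCrit.le_of_le {v : Agent → ℝ} {k : ℕ} {i : Agent} {x y p q : ℝ}
    (h : IsCrit v k i x y p) (hq : q ∈ Set.Icc 0 x)
    (hle : util v k i x (y - min q y) ≤ v i + util v k i (x - q) y) : q ≤ p := by
  by_contra! hlt
  exact hle.not_gt (((isCrit_iff ..).1 h).2.1 q hq hlt)

/-- For the last item the critical price is the whole budget, since the item is worth more; thus the
final round needs no separate treatment below. -/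
theorem reservePrice_eq {v : Agent → ℝ} {k : ℕ} {i : Agent} {x y p : ℝ}
    (hd : Dominated v k x y) (h : IsCrit v k i x y p) :
    reservePrice v k (canonicalUtility v k) (budgets i x y) i = p := by
  unfold reservePrice
  split_ifs with h0
  · subst h0
    rw [budgets_self]
    refine IsCriticalPrice.unique (?_ : IsCrit v 0 i x y x) h
    rw [isCrit_iff]
    refine ⟨⟨hd.left_nonneg, le_rfl⟩, fun q hq hlt => absurd hq.2 hlt.not_ge, fun q hq _ => ?_⟩
    rw [util_zero, util_zero]
    linarith [hd.lt_value i, hq.2]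
  · have hex : ∃ p, IsCriticalPrice v (canonicalUtility v k) i (budgets i x y) p := ⟨p, h⟩
    rw [criticalPrice, dif_pos hex]
    exact IsCriticalPrice.unique hex.choose_spec h

section
variable {v : Agent → ℝ} {k : ℕ} {i : Agent} {x y p p' : ℝ} (hd : Dominated v k x y)
include hd

theorem reservePrice_opponent_eq (h : IsCrit v k (opponent i) y x p) :
    reservePrice v k (canonicalUtility v k) (budgets i x y) (opponent i) = p := by
  rw [← budgets_swap]
  exact reservePrice_eq hd.symm h

theorem IsCrit.util_succ_of_lt (hi : IsCrit v k i x y p) (ho : IsCrit v k (opponent i) y x p')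
    (hlt : p' < p) :
    util v (k + 1) i x y = v i + util v k i (x - p') y ∧
      util v (k + 1) (opponent i) y x = util v k (opponent i) y (x - p') :=
  _root_.util_succ_of_lt (reservePrice_eq hd hi) (reservePrice_opponent_eq hd ho) hlt

theorem IsCrit.util_succ_of_eq (hi : IsCrit v k i x y p) (ho : IsCrit v k (opponent i) y x p) :
    util v (k + 1) i x y = (v i + util v k i (x - p) y + util v k i x (y - p)) / 2 :=
  _root_.util_succ_of_eq (reservePrice_eq hd hi) (reservePrice_opponent_eq hd ho)

end

/-! ### The induction step for the form of the utilities -/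

theorem mul_lt_of_lt_sub_div {n c : ℕ} {x y q : ℝ} (h : q < x - n * y / (c + 2)) :
    n * y < (c + 2) * (x - q) := by
  rw [lt_sub_comm, div_lt_iff₀ (by positivity)] at h
  linarith

section
variable {v : Agent → ℝ} {k : ℕ} (F : UtilityForm v k)
include F

theorem UtilityForm.all_succ (i : Agent) {x y : ℝ} (hd : Dominated v (k + 1) x y)
    (h : (k + 1) * y < x) :
    util v (k + 1) i x y = (k + 1) * v i + (x - (k + 1) * y) ∧
      util v (k + 1) (opponent i) y x = y := by
  have hd := hd.of_succ
  have hy := hd.right_nonneg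
  have hky : (0 : ℝ) ≤ k * y := by positivity
  have ho : IsCrit v k (opponent i) y x y := by
    rw [isCrit_iff]
    refine ⟨⟨hy, le_rfl⟩, fun q hq hlt => absurd hq.2 hlt.not_ge, fun q hq hlt => ?_⟩
    have hkq : (k : ℝ) * q ≤ k * y := by gcongr
    have hkq0 : (0 : ℝ) ≤ k * q := mul_nonneg (Nat.cast_nonneg _) hq.1
    have hqx : q ≤ x := by linarith [hq.2]
    rw [min_eq_left hqx,
      (F.all i (x - q) y (hd.anti (by linarith) (by linarith [hq.1]) hy le_rfl) (by linarith)).2,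
      (F.all i x (y - q) (hd.anti hd.left_nonneg le_rfl (by linarith) (by linarith [hq.1]))
        (by linarith)).2]
    linarith [hd.symm.lt_value (opponent i)]
  obtain ⟨p, hp⟩ := F.mono.exists_isCrit hd i
  -- Paying such a `q` still leaves more than `k * y`, hence all later items: the agent competes
  -- strictly beyond `y`, the most the opponent can bid.
  obtain ⟨q, hyq, hqx⟩ := exists_between (show y < x - k * y by linarith)
  have hqp : q ≤ p := by
    refine hp.le_of_le ⟨by linarith, by linarith⟩ ?_
    rw [min_eq_right hyq.le, sub_self,
      (F.all i x 0 (hd.anti hd.left_nonneg le_rfl le_rfl hy) (by linarith)).1,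
      (F.all i (x - q) y (hd.anti (by linarith) (by linarith) hy le_rfl) (by linarith)).1]
    linarith [hd.lt_value i]
  obtain ⟨h1, h2⟩ := hp.util_succ_of_lt hd ho (hyq.trans_le hqp)
  have h3 := F.all i (x - y) y (hd.anti (by linarith) (by linarith) hy le_rfl) (by linarith)
  rw [h1, h2, h3.1, h3.2]
  exact ⟨by ring, rfl⟩

theorem UtilityForm.origin_succ (i : Agent) (hd : Dominated v (k + 1) 0 0) :
    0 ≤ util v (k + 1) i 0 0 ∧ util v (k + 1) i 0 0 ≤ (k + 1) * v i := by
  have hd := hd.of_succ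
  have key : ∀ j, IsCrit v k j 0 0 0 := fun j => by
    obtain ⟨p, hp⟩ := F.mono.exists_isCrit hd j
    have := ((isCrit_iff ..).1 hp).1
    rwa [le_antisymm this.2 this.1] at hp
  rw [(key i).util_succ_of_eq hd (key _), sub_zero]
  have h1 := F.origin i hd
  have h2 := hd.value_pos i
  have h3 : (0 : ℝ) ≤ k * v i := by positivity
  exact ⟨by linarith, by linarith⟩

/-- With balanced budgets both agents compete up to the same price. -/
theorem UtilityForm.isCrit_balanced (i : Agent) {j d : ℕ} {z : ℝ} (hk : j + d = k) (hz : 0 < z)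
    (hd : Dominated v k ((j + 1) * z) ((d + 1) * z)) :
    IsCrit v k i ((j + 1) * z) ((d + 1) * z) z := by
  have hx := hd.left_nonneg
  have hy := hd.right_nonneg
  have hjz : 0 ≤ (j : ℝ) * z := by positivity
  have hdz : 0 ≤ (d : ℝ) * z := by positivity
  rw [isCrit_iff]
  refine ⟨⟨hz.le, by linarith⟩, fun q hq hlt => ?_, fun q hq hlt => ?_⟩
  · obtain ⟨m, rfl⟩ : ∃ m, j = m + 1 := by
      refine Nat.exists_eq_succ_of_ne_zero ?_
      rintro rfl
      have := hq.2
      push_cast at this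
      linarith
    have h1 := F.util_le (n := m) (c := d + 1) i (by omega)
      (hd.anti (x' := ((m + 1 : ℕ) + 1) * z - q) (by linarith [hq.2]) (by linarith) hy le_rfl)
      (by push_cast; nlinarith)
    have hmin : 0 ≤ ((d : ℝ) + 1) * z - min q ((d + 1) * z) := sub_nonneg.2 (min_le_right _ _)
    have hd' := hd.anti hx le_rfl hmin (by
      linarith [le_min (hz.le.trans hlt.le) hy])
    cases d with
    | zero =>
      -- The opponent owns just `z`, so the cap in the losing utility leaves a penniless opponent.
      have h0 : min q (((0 : ℕ) + 1) * z) = z := by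
        rw [min_eq_right] <;> push_cast <;> linarith
      rw [h0, show ((0 : ℕ) + 1 : ℝ) * z - z = 0 by push_cast; ring] at hd' ⊢
      have hkm : (k : ℝ) = m + 1 := by rw [← hk]; push_cast; ring
      rw [(F.all i _ 0 hd' (by simp only [mul_zero]; positivity)).1, hkm]
      push_cast at h1 ⊢
      linarith
    | succ e =>
      have h2 := F.lt_util (n := m + 2) (c := e) i (by omega) hd' (by
        have : (((e + 1 : ℕ) : ℝ) + 1) * z - min q (((e + 1 : ℕ) + 1) * z) < (e + 1) * z := by
          have : 0 < ((e : ℝ) + 1) * z := by positivity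
          rw [sub_lt_comm]
          refine lt_min ?_ ?_ <;> push_cast <;> linarith
        have h3 := mul_lt_mul_of_pos_left this (by positivity : (0 : ℝ) < m + 2)
        push_cast at h3 ⊢
        linarith)
      have h3 := hd.lt_value i
      push_cast at h1 h2 h3 ⊢
      linarith
  · have hqy : q ≤ (d + 1) * z := by linarith
    rw [min_eq_left hqy]
    have h1 := F.lt_util (n := j) (c := d) i hk
      (hd.anti (x' := (j + 1) * z - q) (by linarith [hq.2]) (by linarith [hq.1]) hy le_rfl)
      (by nlinarith)
    have h2 := F.util_le (n := j) (c := d) i hk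
      (hd.anti (y' := (d + 1) * z - q) hx le_rfl (by linarith) (by linarith [hq.1]))
      (by nlinarith)
    linarith [hd.lt_value i]

/-- The coin averages a win and a loss at price `z`. The win is worth at least `j * v i + v i / 2 ^
k`, the loss at least `j * v i`; the surplus halves in each round, which is the source of `2 ^ k`.
-/
theorem UtilityForm.balanced_succ (i : Agent) {j d : ℕ} {z : ℝ} (hk : j + d = k) (hz : 0 < z)
    (hd : Dominated v (k + 1) ((j + 1) * z) ((d + 1) * z)) :
    j * v i + v i / 2 ^ (k + 1) ≤ util v (k + 1) i ((j + 1) * z) ((d + 1) * z) ∧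
      util v (k + 1) i ((j + 1) * z) ((d + 1) * z) ≤ (j + 1) * v i := by
  have hd := hd.of_succ
  have hx := hd.left_nonneg
  have hy := hd.right_nonneg
  rw [(F.isCrit_balanced i hk hz hd).util_succ_of_eq hd
    (F.isCrit_balanced (opponent i) (by omega) hz hd.symm)]
  have hjz : 0 ≤ (j : ℝ) * z := by positivity
  have hdz : 0 ≤ (d : ℝ) * z := by positivity
  have hv := hd.value_pos i
  have hxv := hd.lt_value i
  have h1 : ((j : ℝ) - 1) * v i + v i / 2 ^ k ≤ util v k i ((j + 1) * z - z) ((d + 1) * z) ∧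
      util v k i ((j + 1) * z - z) ((d + 1) * z) ≤ j * v i := by
    have hd' := hd.anti (x' := (j + 1) * z - z) (by linarith) (by linarith) hy le_rfl
    cases j with
    | zero =>
      rw [show ((0 : ℕ) + 1 : ℝ) * z - z = 0 by push_cast; ring] at hd' ⊢
      rw [F.none i hd' (by rw [mul_zero]; positivity)]
      have : v i / 2 ^ k ≤ v i := div_le_self hv.le (one_le_pow₀ one_le_two)
      push_cast
      exact ⟨by linarith, by linarith⟩
    | succ m =>
      rw [show ((m + 1 : ℕ) + 1 : ℝ) * z - z = (m + 1) * z by push_cast; ring] at hd' ⊢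
      have := F.balanced i m (d + 1) z (by omega) hz (by exact_mod_cast hd') (by simp)
      push_cast at this ⊢
      exact ⟨by linarith, by linarith⟩
  have h2 : j * v i ≤ util v k i ((j + 1) * z) ((d + 1) * z - z) ∧
      util v k i ((j + 1) * z) ((d + 1) * z - z) ≤ (j + 1) * v i := by
    have hd' := hd.anti (y' := (d + 1) * z - z) hx le_rfl (by linarith) (by linarith)
    cases d with
    | zero =>
      rw [show ((0 : ℕ) + 1 : ℝ) * z - z = 0 by push_cast; ring] at hd' ⊢
      rw [(F.all i _ 0 hd' (by simp only [mul_zero]; positivity)).1, ← hk]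
      push_cast
      exact ⟨by linarith, by linarith⟩
    | succ m =>
      rw [show ((m + 1 : ℕ) + 1 : ℝ) * z - z = (m + 1 : ℕ) * z by push_cast; ring] at hd' ⊢
      have := F.balanced i j (m + 1) z (by omega) hz hd' (by simp)
      have : 0 < v i / 2 ^ k := by positivity
      exact ⟨by linarith, by linarith⟩
  rw [show v i / 2 ^ (k + 1) = v i / 2 ^ k / 2 by rw [pow_succ]; field_simp]
  exact ⟨by linarith, by linarith⟩

/-- The agent with more money per item competes up to the first price. -/
theorem UtilityForm.isCrit_firstPrice (i : Agent) {n c : ℕ} {x y : ℝ} (hk : n + 1 + c = k)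
    (hd : Dominated v k x y) (h : IsSplit (n + 1) (c + 1) x y) :
    IsCrit v k (opponent i) y x (firstPrice n c x y) := by
  have hx := h.pos_left
  have hc : 0 ≤ ((c : ℝ) + 1) * x / (n + 2) := by positivity
  set P := firstPrice n c x y with hP
  have hP0 : 0 < P := (by positivity : 0 < x / ((n : ℝ) + 2)).trans_le (le_firstPrice n c y hx.le)
  have hPx := h.firstPrice_lt
  have hPy := h.firstPrice_le
  have hPIcc : P ∈ Set.Icc 0 y := ⟨hP0.le, by linarith⟩
  have lose (q : ℝ) (hq : P ≤ q) (hqx : n * y < (c + 2) * (x - q)) :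
      util v k (opponent i) y (x - q) =
        (c + 1) * v (opponent i) + (y - (c + 1) * leftoverFun n (c + 1) (x - q) y) := by
    have hs := h.win hq hqx
    have := (F.split i n (c + 1) (x - q) y (by omega)
      (hd.anti hs.nonneg (by linarith) h.pos.le le_rfl) hs).2
    exact_mod_cast this
  have win (q : ℝ) (h0 : 0 ≤ q) (hq : y - (c + 1) * x / (n + 1) < q)
      (hq' : q ≤ y - (c + 1) * x / (n + 2)) :
      util v k (opponent i) (y - q) x =
        c * v (opponent i) + (y - q - c * leftoverFun (n + 1) c x (y - q)) := by
    have hs := h.lose hq hq'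
    exact (F.split i (n + 1) c x (y - q) hk
      (hd.anti hx.le le_rfl hs.pos.le (by linarith)) hs).2
  rcases (firstPrice_ge n c x y).eq_or_lt with hβ | hβ
  · have hPγ : P < y - (c + 1) * x / (n + 2) := by
      rw [hP, ← hβ]; exact h.lower_lt_upper
    refine F.mono.isCrit_of_le hd.symm hPIcc ?_ fun q hq hlt => ?_
    · rw [min_eq_left hPx.le, lose P le_rfl h.mul_lt_firstPrice]
      have h1 : 0 < leftoverFun n (c + 1) (x - P) y := h.leftoverFun_sub_firstPrice_pos
      have h2 : 0 < ((c : ℝ) + 1) * leftoverFun n (c + 1) (x - P) y := by positivity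
      have h3 : (n + 1 : ℕ) * (y - P) = (c + 1) * x := by
        rw [hP, ← hβ]; push_cast; field_simp; ring
      -- Winning at the floor price leaves balanced budgets, whose surplus `v / 2 ^ k` exceeds all
      -- of the money `y`.
      have h4 := (F.balanced_bounds (n := c) (c := n + 1) (opponent i) (by omega)
        (hd.symm.anti (x' := y - P) (by linarith) (by linarith) hx.le le_rfl)
        (by linarith) (by simp) h3).1
      have h5 : y < v (opponent i) / 2 ^ k := by
        rw [lt_div_iff₀ (by positivity)]; linarith [hd.right_lt (opponent i)]
      linarith
    · have h0 : P < x - n * y / (c + 2) := by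
        rw [lt_sub_comm, div_lt_iff₀ (by positivity)]; linarith [h.mul_lt_firstPrice]
      -- The formulas are available only just above `P`; monotonicity carries the preference from
      -- `q'` to `q`.
      obtain ⟨q', hPq, hq'⟩ := exists_between (lt_min hlt (lt_min hPγ h0))
      rw [lt_min_iff, lt_min_iff] at hq'
      have hq'' := mul_lt_of_lt_sub_div hq'.2.2
      have hqx : q' ≤ x := by
        have h1 : (0 : ℝ) ≤ n * y := mul_nonneg (Nat.cast_nonneg _) h.pos.le
        have h2 : 0 < x - q' := pos_of_mul_pos_right (h1.trans_lt hq'') (by positivity)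
        linarith
      have h1 := F.mono.winning_lt (i := opponent i) hd.symm (by linarith) hq'.1 hq.2
      have h2 := F.mono.losing_le (i := opponent i) hd.symm (by linarith) hq'.1.le
      rw [min_eq_left hqx, lose q' hPq.le hq''] at h2
      rw [win q' (by linarith) (by rw [hβ]; exact hPq) hq'.2.1.le] at h1
      have h3 := lt_of_firstPrice_lt hPq
      linarith
  · refine F.mono.isCrit_of_eq hd.symm hPIcc ?_
    have h1 := (firstPrice_eq_or n c x y).resolve_left hβ.ne'
    rw [min_eq_left hPx.le, lose P le_rfl h.mul_lt_firstPrice, win P hP0.le hβ hPy]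
    linarith

/-- Either the first agent strictly prefers to win at `P`, and by continuity also slightly above it,
or she is indifferent at `P`. In the latter case she may tie, but then the opponent is indifferent
too, so the expected utilities are as if the first agent had won. -/
theorem UtilityForm.split_succ (i : Agent) {n c : ℕ} {x y : ℝ} (hk : n + 1 + c = k)
    (hd : Dominated v k x y) (h : IsSplit (n + 1) (c + 1) x y) :
    util v (k + 1) i x y = v i + util v k i (x - firstPrice n c x y) y ∧
      util v (k + 1) (opponent i) y x = util v k (opponent i) y (x - firstPrice n c x y) := by
  have hx := h.pos_left
  have hc : 0 ≤ ((c : ℝ) + 1) * x / (n + 2) := by positivity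
  have ho := F.isCrit_firstPrice i hk hd h
  set P := firstPrice n c x y with hP
  have hP0 : 0 < P := (by positivity : 0 < x / ((n : ℝ) + 2)).trans_le (le_firstPrice n c y hx.le)
  have hPx : P < x := h.firstPrice_lt
  have hPy : P ≤ y - (c + 1) * x / (n + 2) := h.firstPrice_le
  have win (q : ℝ) (hq : P ≤ q) (hqx : n * y < (c + 2) * (x - q)) :
      util v k i (x - q) y = n * v i + leftoverFun n (c + 1) (x - q) y := by
    have hs := h.win hq hqx
    exact (F.split i n (c + 1) (x - q) y (by omega)
      (hd.anti hs.nonneg (by linarith) h.pos.le le_rfl) hs).1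
  have lose (q : ℝ) (h0 : 0 ≤ q) (hq : y - (c + 1) * x / (n + 1) < q)
      (hq' : q ≤ y - (c + 1) * x / (n + 2)) :
      util v k i x (y - q) = (n + 1) * v i + leftoverFun (n + 1) c x (y - q) := by
    have hs := h.lose hq hq'
    have := (F.split i (n + 1) c x (y - q) hk
      (hd.anti hx.le le_rfl hs.pos.le (by linarith)) hs).1
    exact_mod_cast this
  obtain ⟨p, hp⟩ := F.mono.exists_isCrit hd i
  rcases lt_or_ge (leftoverFun (n + 1) c x (y - P)) (leftoverFun n (c + 1) (x - P) y) with hlt | hle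
  · have hγ := h.firstPrice_lt_of_lt hlt
    refine hp.util_succ_of_lt hd ho ?_
    have h0 : P < x - n * y / (c + 2) := by
      rw [lt_sub_comm, div_lt_iff₀ (by positivity)]; linarith [h.mul_lt_firstPrice]
    have hA : Continuous fun q => leftoverFun n (c + 1) (x - q) y :=
      (leftoverFun_isMonoAnti n (c + 1)).cont.comp
        ((continuous_const.sub continuous_id).prodMk continuous_const)
    have hB : Continuous fun q => leftoverFun (n + 1) c x (y - q) :=
      (leftoverFun_isMonoAnti (n + 1) c).cont.comp
        (continuous_const.prodMk (continuous_const.sub continuous_id))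
    have hev := (hB.continuousAt.eventually_lt hA.continuousAt hlt).filter_mono
      (nhdsWithin_le_nhds (s := Set.Ioi P))
    obtain ⟨q, hq, hqγ, hPq⟩ := (hev.and ((Ioo_mem_nhdsGT (lt_min hγ h0)))).exists
    rw [lt_min_iff] at hPq
    have hq' := mul_lt_of_lt_sub_div hPq.2
    refine hqγ.trans_le (hp.le_of_le ⟨by linarith, ?_⟩ ?_)
    · have := (h.win hqγ.le hq').nonneg
      linarith
    · rw [min_eq_left (by linarith), win q hqγ.le hq',
        lose q (by linarith) ((firstPrice_ge n c x y).trans_lt hqγ) hPq.1.le]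
      linarith
  · obtain ⟨hβ, h1, h2⟩ := h.firstPrice_eq_of_le hle
    have e1 := win P le_rfl h.mul_lt_firstPrice
    have e2 := lose P hP0.le hβ hPy
    have e3 : util v k i x (y - P) = v i + util v k i (x - P) y := by
      rw [e1, e2]; linarith
    have hPp : P ≤ p := by
      refine hp.le_of_le ⟨hP0.le, hPx.le⟩ ?_
      rw [min_eq_left (by linarith), e3]
    rcases hPp.eq_or_lt with rfl | hPp
    -- Both leftovers equal `P`, so the coin changes neither agent's utility.
    · have hs := h.win le_rfl h.mul_lt_firstPrice
      have hs' := h.lose hβ hPy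
      have f1 := (F.split i n (c + 1) (x - P) y (by omega)
        (hd.anti hs.nonneg (by linarith) h.pos.le le_rfl) hs).2
      have f2 := (F.split i (n + 1) c x (y - P) hk
        (hd.anti hx.le le_rfl hs'.pos.le (by linarith)) hs').2
      have t1 := hp.util_succ_of_eq hd ho
      have t2 := ho.util_succ_of_eq hd.symm (by rwa [opponent_opponent])
      rw [h2] at f1
      rw [h1] at f2
      refine ⟨by rw [t1, e3]; ring, ?_⟩
      rw [t2, f1, f2]
      push_cast
      ring
    · exact hp.util_succ_of_lt hd ho hPp

theorem UtilityForm.succ : UtilityForm v (k + 1) where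
  all i x y hd h := by
    push_cast at h ⊢
    exact F.all_succ i hd h
  split i n c x y hk hd h := by
    cases n with
    | zero =>
      obtain rfl : c = k + 1 := by omega
      have hx := h.nonneg
      have hlt : ((k : ℝ) + 1) * x < y := by
        have := h.upper
        have := h.pos
        push_cast at *
        rcases hx.eq_or_lt with rfl | hx <;> linarith
      have := F.all_succ (opponent i) hd.symm hlt
      rw [opponent_opponent] at this
      rw [this.1, this.2, leftoverFun_zero]
      push_cast
      exact ⟨by ring, rfl⟩
    | succ n =>
      cases c with
      | zero =>
        obtain rfl : n = k := by omega
        have h1 := h.lower (by simp)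
        have h2 := h.upper
        push_cast at h1 h2
        have := F.all_succ i hd (by linarith)
        -- Within the region `x ≤ (n + 2) * y`, so the minimum is the money left after paying `y`
        -- for every item.
        rw [this.1, this.2, leftoverFun_succ_zero, min_eq_right]
        · push_cast
          exact ⟨by ring, by ring⟩
        · rw [le_div_iff₀ (by positivity)]
          nlinarith
      | succ c =>
        have hs := F.split_succ i (by omega) hd.of_succ h
        have hw := h.win le_rfl h.mul_lt_firstPrice
        have h1 := F.split i n (c + 1) _ y (by omega)
          (hd.of_succ.anti hw.nonneg (by
            linarith [le_firstPrice n c y h.nonneg, div_nonneg h.nonneg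
              (by positivity : (0 : ℝ) ≤ n + 2)]) h.pos.le le_rfl) hw
        rw [hs.1, hs.2, h1.1, h1.2, leftoverFun_succ_succ]
        push_cast
        exact ⟨by ring, rfl⟩
  balanced i j d z hk hz hd h0 := by
    obtain ⟨e, rfl⟩ := Nat.exists_eq_succ_of_ne_zero h0
    have := F.balanced_succ i (j := j) (d := e) (z := z) (by omega) hz (by exact_mod_cast hd)
    exact_mod_cast this
  origin i hd := by
    push_cast
    exact F.origin_succ i hd

end

theorem utilityForm (v : Agent → ℝ) (k : ℕ) : UtilityForm v k := by
  induction k with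
  | zero =>
    refine ⟨fun i x y _ _ => ?_, fun i n c x y hk _ h => ?_, fun i j d z hk _ _ h => by omega,
      fun i _ => ?_⟩
    · simp [util_zero]
    · obtain rfl : n = 0 := by omega
      obtain rfl : c = 0 := by omega
      simp [util_zero, leftoverFun_zero]
    · simp [util_zero]
  | succ k ih => exact ih.succ

theorem mainTheorem5 (k : ℕ) (hk : 1 ≤ k) (v : Agent → ℝ) :
    -- the critical prices in the definition of the canonical outcome exist
    (2 ≤ k → ∀ B : Agent → ℝ, ValuesDominate k v B → ∀ i : Agent,
      ∃! p : ℝ, IsCriticalPrice v (canonicalUtility v (k - 1)) i B p) ∧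
    -- the utility is strictly increasing in the own budget
    (∀ (i : Agent) (x x' y : ℝ),
      ValuesDominate k v (budgets i x y) → ValuesDominate k v (budgets i x' y) → x < x' →
      canonicalUtility v k (budgets i x y) i < canonicalUtility v k (budgets i x' y) i) ∧
    -- the utility is non-increasing in the budget of the opponent
    (∀ (i : Agent) (x y y' : ℝ),
      ValuesDominate k v (budgets i x y) → ValuesDominate k v (budgets i x y') → y ≤ y' →
      canonicalUtility v k (budgets i x y') i ≤ canonicalUtility v k (budgets i x y) i) := by
  simp only [valuesDominate_budgets_iff]
  refine ⟨fun _ B hB i => ?_, fun i x x' y h h' hlt => ?_, fun i x y y' h h' hle => ?_⟩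
  · obtain ⟨m, rfl⟩ := Nat.exists_eq_add_of_le' hk
    rw [← budgets_eta i B, valuesDominate_budgets_iff] at hB
    obtain ⟨p, hp⟩ := (utilityForm v m).mono.exists_isCrit hB.of_succ i
    rw [IsCrit, budgets_eta] at hp
    exact ⟨p, hp, fun q hq => IsCriticalPrice.unique hq hp⟩
  · exact (utilityForm v k).mono.own i x x' y h' h.left_nonneg hlt
  · exact (utilityForm v k).mono.opp i x y y' h' h.right_nonneg hle
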